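/- **Proposition 6.3.** Let $\Lambda\subset\mathbb C$ be a lattice (for example $\Lambda=\mathbb Z+\mathbb Z\tau$ with $\operatorname{Im}\tau>0$), $E=\mathbb C/\Lambda$, and let $\wp$ be the Weierstrass function of $\Lambda$ with invariants $g_2,g_3$, so that $\wp'^2=4\wp^3-g_2\wp-g_3$. Let $L(a,b,c)$ be the space of all meromorphic functions of $(z,w)$ on $E\times E$ which are regular or have poles of order at most $a$ on $\{0\}\times E$, at most $b$ on $E\times\{0\}$ and at most $c$ on the diagonal, and which are regular elsewhere. Let $M(4,4,4)$ be the complex vector space spanned by the 64 products $A(z)B(w)C(z-w)$ with $A,B,C\in\{1,\wp,\wp',\wp''\}$. Put $$\begin{aligned} f_1={}&\wp'(z)-\wp'(w)-\wp'(z-w),\\ f_2={}&\wp(z)\wp'(w)-\wp'(z)\wp(w)+\wp'(w)\wp(z-w)+\wp(w)\wp'(z-w)-\wp'(z)\wp(z-w)+\wp(z)\wp'(z-w),\\ f_3={}&\wp''(z)\wp'(w)-\wp'(z)\wp''(w)+\wp'(w)\wp''(z-w)+\wp''(w)\wp'(z-w)-\wp'(z)\wp''(z-w)+\wp''(z)\wp'(z-w),\\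 f_4={}&\wp(z)\wp(w)\wp'(z-w)-\wp'(z)\wp(w)\wp(z-w)+\wp(z)\wp'(w)\wp(z-w),\\ f_5={}&\wp(z)\wp''(w)\wp'(z-w)+\wp''(z)\wp(w)\wp'(z-w)-\wp'(z)\wp''(w)\wp(z-w)\\ &-\wp'(z)\wp(w)\wp''(z-w)+\wp''(z)\wp'(w)\wp(z-w)+\wp(z)\wp'(w)\wp''(z-w),\\ f_7={}&\wp'(z)\wp'(w)\wp'(z-w). \end{aligned}$$ Then the functions $$F_1=f_3-30f_4-\tfrac52 g_2f_1,\qquad F_2=2f_5-9f_7-5g_2f_2+15g_3f_1$$ lie in $L(1,1,1)\cap M(4,4,4)$, and each of them has a pole of order exactly $1$ along each of the three divisors $\{0\}\times E$, $E\times\{0\}$ and the diagonal. For every $w\in\mathbb C\setminus\Lambda$, $$\lim_{z\to0}zF_1(z,w)=-36g_2\wp(w)-54g_3,\qquad \lim_{z\to0}zF_2(z,w)=108g_3\wp(w)+6g_2^2.$$ The functions $1,F_1,F_2$ are linearly independent over $\mathbb C$ and span $L(1,1,1)$; that is, they form a basis of $L(1,1,1)$. -/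

import Mathlib

open Filter Topology

noncomputable section

namespace EllipticSquare

variable (Λ : PeriodPair)

/-- The complement in `ℂ × ℂ` of the preimages of the three divisors `{0} × E`, `E × {0}` and the
diagonal of `E × E`, where `E = ℂ / Λ`. -/
def offDivisors : Set (ℂ × ℂ) :=
  {q | q.1 ∉ Λ.lattice ∧ q.2 ∉ Λ.lattice ∧ q.1 - q.2 ∉ Λ.lattice}

/-- The restriction of a function of two variables to the complement of the three divisors.
(Values on the divisors, where the function may have poles, are meaningless.) -/
def restrict (F : ℂ → ℂ → ℂ) : offDivisors Λ → ℂ := fun q => F q.1.1 q.1.2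

open Classical in
/-- A local equation, near `u₀`, of `m` times the divisor `Λ ⊆ ℂ`: it is `(u - u₀) ^ m` if `u₀` is
a lattice point, and `1` otherwise. -/
def localEquation (m : ℕ) (u₀ u : ℂ) : ℂ :=
  if u₀ ∈ Λ.lattice then (u - u₀) ^ m else 1

/-- A local equation, near the point `p`, of the divisor
`a • ({0} × E) + b • (E × {0}) + c • diagonal` on `E × E`, pulled back to `ℂ × ℂ`. -/
def divisorEquation (a b c : ℕ) (p q : ℂ × ℂ) : ℂ :=
  localEquation Λ a p.1 q.1 * localEquation Λ b p.2 q.2 *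
    localEquation Λ c (p.1 - p.2) (q.1 - q.2)

/-- The space `L(a, b, c)` of all meromorphic functions on `E × E`, `E = ℂ / Λ`, which are regular
or have poles of order at most `a` on `{0} × E`, at most `b` on `E × {0}`, at most `c` on the
diagonal, and which are regular elsewhere.

Such a function is given by its (holomorphic) restriction to the complement of the three divisors,
i.e. by a function `f` on `offDivisors Λ` that is invariant under translations by `Λ × Λ` and such
that near every point `p` of `ℂ × ℂ` the product of `f` with the local equation of the divisor
extends to a holomorphic function `h` at `p`. (At the points `p` of `offDivisors Λ` the local
equation is `1`, so that `f` is holomorphic there.) -/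
def poleSpace (a b c : ℕ) : Submodule ℂ (offDivisors Λ → ℂ) where
  carrier := {f |
    (∀ q q' : offDivisors Λ, q'.1.1 - q.1.1 ∈ Λ.lattice → q'.1.2 - q.1.2 ∈ Λ.lattice →
      f q' = f q) ∧
    ∀ p : ℂ × ℂ, ∃ h : ℂ × ℂ → ℂ, AnalyticAt ℂ h p ∧
      ∀ᶠ q in 𝓝 p, ∀ hq : q ∈ offDivisors Λ, h q = divisorEquation Λ a b c p q * f ⟨q, hq⟩}
  zero_mem' := ⟨fun _ _ _ _ => rfl, fun _ => ⟨0, analyticAt_const, by simp⟩⟩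
  add_mem' := by
    rintro f g ⟨hf, hf'⟩ ⟨hg, hg'⟩
    refine ⟨fun q q' h₁ h₂ => ?_, fun p => ?_⟩
    · simp [hf q q' h₁ h₂, hg q q' h₁ h₂]
    · obtain ⟨h, hh, he⟩ := hf' p
      obtain ⟨k, hk, ke⟩ := hg' p
      refine ⟨h + k, hh.add hk, ?_⟩
      filter_upwards [he, ke] with q h₁ h₂ hq
      simp [h₁ hq, h₂ hq, mul_add]
  smul_mem' := by
    rintro r f ⟨hf, hf'⟩
    refine ⟨fun q q' h₁ h₂ => ?_, fun p => ?_⟩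
    · simp [hf q q' h₁ h₂]
    · obtain ⟨h, hh, he⟩ := hf' p
      refine ⟨fun q => r * h q, analyticAt_const.mul hh, ?_⟩
      filter_upwards [he] with q h₁ hq
      simp [h₁ hq, mul_left_comm]

/-- The Weierstrass function `℘` of the lattice. -/
abbrev wp : ℂ → ℂ := Λ.weierstrassP

/-- Its derivative `℘'`. -/
abbrev wp' : ℂ → ℂ := Λ.derivWeierstrassP

/-- Its second derivative `℘''`. -/
def wp'' : ℂ → ℂ := deriv (wp' Λ)

/-- The row `1, ℘(u), ℘'(u), ℘''(u)`. -/
def wpRow (u : ℂ) : Fin 4 → ℂ := ![1, wp Λ u, wp' Λ u, wp'' Λ u]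

/-- The space `M(4a, 4b, 4c)`, spanned by all products of `a` elements of the row of `z`, `b`
elements of the row of `w` and `c` elements of the row of `z - w`. -/
def productSpace (a b c : ℕ) : Submodule ℂ (offDivisors Λ → ℂ) :=
  Submodule.span ℂ {f | ∃ (i : Fin a → Fin 4) (j : Fin b → Fin 4) (k : Fin c → Fin 4),
    f = restrict Λ fun z w =>
      (∏ s, wpRow Λ z (i s)) * (∏ s, wpRow Λ w (j s)) * ∏ s, wpRow Λ (z - w) (k s)}

def f₁ (z w : ℂ) : ℂ := wp' Λ z - wp' Λ w - wp' Λ (z - w)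

def f₂ (z w : ℂ) : ℂ :=
  wp Λ z * wp' Λ w - wp' Λ z * wp Λ w + wp' Λ w * wp Λ (z - w) + wp Λ w * wp' Λ (z - w)
    - wp' Λ z * wp Λ (z - w) + wp Λ z * wp' Λ (z - w)

def f₃ (z w : ℂ) : ℂ :=
  wp'' Λ z * wp' Λ w - wp' Λ z * wp'' Λ w + wp' Λ w * wp'' Λ (z - w) + wp'' Λ w * wp' Λ (z - w)
    - wp' Λ z * wp'' Λ (z - w) + wp'' Λ z * wp' Λ (z - w)

def f₄ (z w : ℂ) : ℂ :=
  wp Λ z * wp Λ w * wp' Λ (z - w) - wp' Λ z * wp Λ w * wp Λ (z - w)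
    + wp Λ z * wp' Λ w * wp Λ (z - w)

def f₅ (z w : ℂ) : ℂ :=
  wp Λ z * wp'' Λ w * wp' Λ (z - w) + wp'' Λ z * wp Λ w * wp' Λ (z - w)
    - wp' Λ z * wp'' Λ w * wp Λ (z - w) - wp' Λ z * wp Λ w * wp'' Λ (z - w)
    + wp'' Λ z * wp' Λ w * wp Λ (z - w) + wp Λ z * wp' Λ w * wp'' Λ (z - w)

def f₇ (z w : ℂ) : ℂ := wp' Λ z * wp' Λ w * wp' Λ (z - w)

/-- `F₁ = f₃ - 30 f₄ - (5/2) g₂ f₁`. -/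
def F₁ (z w : ℂ) : ℂ := f₃ Λ z w - 30 * f₄ Λ z w - 5 / 2 * Λ.g₂ * f₁ Λ z w

/-- `F₂ = 2 f₅ - 9 f₇ - 5 g₂ f₂ + 15 g₃ f₁`. -/
def F₂ (z w : ℂ) : ℂ :=
  2 * f₅ Λ z w - 9 * f₇ Λ z w - 5 * Λ.g₂ * f₂ Λ z w + 15 * Λ.g₃ * f₁ Λ z w

end EllipticSquare

end

/-!
Every element `f` of `L(1, 1, 1)` has a residue `R w = lim z * f (z, w)` along `z = 0`, an elliptic
function of `w`. Where the three divisors meet, at the origin, it inherits the poles of the other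
two, so it has at most a double pole there, and `R = α + β * ℘`
(`exists_tendsto_affine_wp`). If `R = 0`, then `f` lies in `L(0, 1, 1)`. In that case, for fixed
`w`, it is an elliptic function of `z` with at most one simple pole, hence independent of `z`, and
then it is in the same way independent of `w` (`exists_eq_const_of_mem_poleSpace_zero_one_one`). So
`L(1, 1, 1)` has dimension at most `3`. The residues of `F₁` and `F₂` are linearly independent
because the determinant of their coefficients is a multiple of the discriminant `g₂³ - 27 g₃²`, and
the basis follows.

The discriminant does not vanish since `℘` takes distinct values at the three half periods; this
comes from uniqueness for the differential equation `℘'' = 6 ℘² - g₂ / 2`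
(`sub_mem_lattice_of_wp_eq`). The same fact replaces the residue theorem in the proof that an
elliptic function `f` with at most one simple pole is constant (`EllipticPoleLE.eq_const_of_one`):
the square of the odd part of `f` is affine in `℘`, yet it vanishes at all half periods.

That `F₁` and `F₂` belong to `L(1, 1, 1)` rests on the computation of their residues from the Taylor
expansion of `℘(z - w)` in `z` (`tendsto_mul_F₁`, `tendsto_mul_F₂`). As linear
combinations of the given products they lie in `L(4, 4, 4)`. The existence of the residue lowers the pole order along `z = 0` to
`1`, also at the points where the divisors intersect, because an analytic function of two variables
that vanishes on a line is divisible by the equation of the line (`exists_analyticAt_eq_sub_mul`,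
`mem_poleSpace_of_tendsto`). The automorphisms `(z, w) ↦ (-w, -z)` and `(z, w) ↦ (w - z, w)` permute
the divisors and fix `F₁` and `F₂`, so the other two divisors need no separate computation.
-/

namespace EllipticSquare

/-! ### Analytic functions of one and two variables -/

/-- Averaging an analytic function over a continuous family of linear contractions gives an
analytic function: its power series is obtained by integrating the terms of the given one. -/
lemma analyticAt_integral_comp_clm {E : Type*} [NormedAddCommGroup E] [NormedSpace ℂ E]
    {f : E → ℂ} (hf : AnalyticAt ℂ f 0) {L : ℝ → E →L[ℂ] E} (hL : Continuous L)
    (hL1 : ∀ t ∈ Set.Icc (0 : ℝ) 1, ‖L t‖ ≤ 1) :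
    AnalyticAt ℂ (fun x => ∫ t in (0 : ℝ)..1, f (L t x)) 0 := by
  obtain ⟨P, r, hP⟩ := hf
  have hcont (n : ℕ) : Continuous fun t : ℝ => (P n).compContinuousLinearMap fun _ => L t :=
    ((ContinuousMultilinearMap.compContinuousLinearMapContinuousMultilinear ℂ
      (fun _ : Fin n => E) (fun _ : Fin n => E) ℂ).cont.comp
        (continuous_pi fun _ => hL)).clm_apply continuous_const
  have hmem {t : ℝ} (ht : t ∈ Set.uIoc (0 : ℝ) 1) : t ∈ Set.Icc (0 : ℝ) 1 := by
    rw [Set.uIoc_of_le zero_le_one] at ht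
    exact Set.Ioc_subset_Icc_self ht
  have hbound (n : ℕ) {t : ℝ} (ht : t ∈ Set.uIoc (0 : ℝ) 1) :
      ‖(P n).compContinuousLinearMap fun _ => L t‖ ≤ ‖P n‖ := by
    refine (ContinuousMultilinearMap.norm_compContinuousLinearMap_le _ _).trans ?_
    refine mul_le_of_le_one_right (norm_nonneg _) ?_
    exact Finset.prod_le_one (fun _ _ => norm_nonneg _) fun _ _ => hL1 t (hmem ht)
  let Q : FormalMultilinearSeries ℂ E ℂ := fun n =>
    ∫ t in (0 : ℝ)..1, (P n).compContinuousLinearMap fun _ => L t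
  refine ⟨Q, r, ?_, hP.r_pos, ?_⟩
  · refine hP.r_le.trans (FormalMultilinearSeries.radius_le_of_le fun n => ?_)
    simpa using intervalIntegral.norm_integral_le_of_norm_le_const fun t ht => hbound n ht
  · intro y hy
    have hy' : ENNReal.ofReal ‖y‖ < P.radius := by
      refine lt_of_lt_of_le ?_ hP.r_le
      rwa [Metric.mem_eball, edist_zero_right, ← ofReal_norm] at hy
    have hsum : Summable fun n => ‖P n‖ * ‖y‖ ^ n :=
      P.summable_norm_mul_pow (r := ⟨‖y‖, norm_nonneg _⟩)
        (by rwa [ENNReal.ofReal_eq_coe_nnreal (norm_nonneg _)] at hy')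
    have hQ (n : ℕ) : Q n (fun _ => y) = ∫ t in (0 : ℝ)..1, P n fun _ => L t y := by
      have := ((ContinuousMultilinearMap.apply ℂ (fun _ : Fin n => E) ℂ
        (fun _ => y)).intervalIntegral_comp_comm
          ((hcont n).intervalIntegrable (μ := MeasureTheory.volume) 0 1))
      simpa [Q] using this.symm
    simp only [hQ, zero_add]
    refine intervalIntegral.hasSum_integral_of_dominated_convergence
      (fun n _ => ‖P n‖ * ‖y‖ ^ n) (fun n => ?_) (fun n => .of_forall fun t ht => ?_)
      (.of_forall fun t _ => hsum) ?_ (.of_forall fun t ht => ?_)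
    · have := (ContinuousMultilinearMap.apply ℂ (fun _ : Fin n => E) ℂ
        (fun _ => y)).continuous.comp (hcont n)
      exact this.aestronglyMeasurable
    · refine ((P n).le_opNorm _).trans ?_
      simp only [Finset.prod_const, Finset.card_univ, Fintype.card_fin]
      gcongr
      simpa using (L t).le_of_opNorm_le (hL1 t (hmem ht)) y
    · simp
    · have hLy : L t y ∈ Metric.eball (0 : E) r := by
        rw [Metric.mem_eball, edist_zero_right, ← ofReal_norm] at hy ⊢
        have : ‖L t y‖ ≤ ‖y‖ := by simpa using (L t).le_of_opNorm_le (hL1 t (hmem ht)) y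
        exact (ENNReal.ofReal_le_ofReal this).trans_lt hy
      simpa using hP.hasSum hLy

/-- An analytic function of two variables that vanishes on the line `z = p.1` is divisible by
`z - p.1`. The quotient is the mean of the partial derivative in `z` along the segment from the
line to the given point. -/
lemma exists_analyticAt_eq_sub_mul {h : ℂ × ℂ → ℂ} {p : ℂ × ℂ} (hh : AnalyticAt ℂ h p)
    (h0 : ∀ᶠ w in 𝓝 p.2, h (p.1, w) = 0) :
    ∃ k : ℂ × ℂ → ℂ, AnalyticAt ℂ k p ∧ ∀ᶠ q in 𝓝 p, h q = (q.1 - p.1) * k q := by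
  let f : ℂ × ℂ → ℂ := fun x => fderiv ℂ h (p + x) (1, 0)
  let L : ℝ → ℂ × ℂ →L[ℂ] ℂ × ℂ := fun t =>
    ((t : ℂ) • ContinuousLinearMap.fst ℂ ℂ ℂ).prod (ContinuousLinearMap.snd ℂ ℂ ℂ)
  have hLapp (t : ℝ) (x : ℂ × ℂ) : L t x = (t * x.1, x.2) := by simp [L]
  have hf : AnalyticAt ℂ f 0 := by
    have h1 : AnalyticAt ℂ (fderiv ℂ h) (p + 0) := by simpa using hh.fderiv
    have h2 : AnalyticAt ℂ (fun x => fderiv ℂ h (p + x)) 0 :=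
      h1.comp_of_eq (f := fun x => p + x) (analyticAt_const.add analyticAt_id) rfl
    exact ((ContinuousLinearMap.apply ℂ ℂ ((1, 0) : ℂ × ℂ)).analyticAt _).comp h2
  have hL : Continuous L := by
    have : L = fun t : ℝ => (t : ℂ) • ((ContinuousLinearMap.fst ℂ ℂ ℂ).prod 0) +
        (0 : ℂ × ℂ →L[ℂ] ℂ).prod (ContinuousLinearMap.snd ℂ ℂ ℂ) := by
      ext t <;> simp [L]
    rw [this]
    fun_prop
  have hL1 (t : ℝ) (ht : t ∈ Set.Icc (0 : ℝ) 1) : ‖L t‖ ≤ 1 := by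
    refine ContinuousLinearMap.opNorm_le_bound _ zero_le_one fun x => ?_
    rw [hLapp, one_mul, Prod.norm_def, Prod.norm_def]
    refine max_le_max ?_ le_rfl
    simp only [norm_mul, Complex.norm_real, Real.norm_eq_abs, abs_of_nonneg ht.1]
    exact mul_le_of_le_one_left (norm_nonneg _) ht.2
  have hg := analyticAt_integral_comp_clm hf hL hL1
  refine ⟨fun q => ∫ t in (0 : ℝ)..1, f (L t (q - p)),
    hg.comp_of_eq (f := fun q => q - p) (analyticAt_id.sub analyticAt_const) (sub_self p), ?_⟩
  obtain ⟨ε, hε, hball⟩ := Metric.eventually_nhds_iff_ball.1 hh.eventually_analyticAt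
  have h0' : ∀ᶠ q in 𝓝 p, h (p.1, q.2) = 0 := continuousAt_snd.eventually h0
  filter_upwards [Metric.ball_mem_nhds p hε, h0'] with q hq hq0
  have hmem {t : ℝ} (ht : t ∈ Set.Icc (0 : ℝ) 1) : p + L t (q - p) ∈ Metric.ball p ε := by
    rw [mem_ball_iff_norm] at hq ⊢
    rw [add_sub_cancel_left]
    have := (L t).le_of_opNorm_le (hL1 t ht) (q - p)
    linarith
  have hder (t : ℝ) (ht : t ∈ Set.uIcc (0 : ℝ) 1) :
      HasDerivAt (fun t : ℝ => h (p + L t (q - p))) ((q.1 - p.1) * f (L t (q - p))) t := by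
    rw [Set.uIcc_of_le zero_le_one] at ht
    have h1 : HasDerivAt (fun t : ℝ => p + L t (q - p)) ((q.1 - p.1) • ((1 : ℂ), (0 : ℂ))) t := by
      simp only [hLapp]
      have h2 : HasDerivAt (fun t : ℝ => (t : ℂ) * (q - p).1) (1 * (q - p).1) t :=
        (Complex.ofRealCLM.hasDerivAt (x := t)).mul_const _
      simpa using (h2.prodMk (hasDerivAt_const t (q - p).2)).const_add p
    have h3 := (hball _ (hmem ht)).differentiableAt.hasFDerivAt.restrictScalars ℝ
    have h4 := h3.comp_hasDerivAt t h1
    simpa only [f, Function.comp_def, ContinuousLinearMap.coe_restrictScalars', map_smul,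
      smul_eq_mul] using h4
  have hint : IntervalIntegrable (fun t => (q.1 - p.1) * f (L t (q - p))) MeasureTheory.volume
      0 1 := by
    refine ContinuousOn.intervalIntegrable fun t ht => ContinuousAt.continuousWithinAt ?_
    rw [Set.uIcc_of_le zero_le_one] at ht
    have h1 : ContinuousAt (fderiv ℂ h) (p + L t (q - p)) := (hball _ (hmem ht)).fderiv.continuousAt
    have h2 : ContinuousAt (fun t => p + L t (q - p)) t := by fun_prop
    exact continuousAt_const.mul ((h1.comp_of_eq h2 rfl).clm_apply continuousAt_const)
  have := intervalIntegral.integral_eq_sub_of_hasDerivAt hder hint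
  rw [intervalIntegral.integral_const_mul] at this
  rw [this]
  simp [hLapp, hq0, Prod.add_def]

/-- If `f` vanishes at `x` and `f'` vanishes there to order `n`, then `f` vanishes to order
`n + 1`. -/
lemma succ_le_analyticOrderAt {f g : ℂ → ℂ} {x : ℂ} {n : ℕ} (hf : AnalyticAt ℂ f x)
    (h0 : f x = 0) (hg : ∀ᶠ z in 𝓝 x, HasDerivAt f (g z) z) (hn : n ≤ analyticOrderAt g x) :
    ((n + 1 : ℕ) : ℕ∞) ≤ analyticOrderAt f x := by
  have hd : deriv f =ᶠ[𝓝 x] g := hg.mono fun z hz => hz.deriv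
  have := hf.analyticOrderAt_deriv_add_one
  simp only [h0, sub_zero] at this
  rw [← this, analyticOrderAt_congr hd, Nat.cast_add, Nat.cast_one]
  gcongr

/-! ### The Weierstrass function, its differential equation and the discriminant -/

section

variable (Λ : PeriodPair)

lemma isOpen_compl_lattice : IsOpen ((Λ.lattice : Set ℂ)ᶜ) := Λ.isClosed_lattice.isOpen_compl

lemma countable_lattice : (Λ.lattice : Set ℂ).Countable := by
  have : Countable Λ.lattice := inferInstance
  exact Set.countable_coe_iff.1 this

lemma eventually_notMem_lattice (u₀ : ℂ) : ∀ᶠ u in 𝓝[≠] u₀, u ∉ Λ.lattice := by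
  have h1 := nhdsWithin_le_nhds (s := {u₀}ᶜ) (Λ.compl_lattice_sdiff_singleton_mem_nhds u₀)
  filter_upwards [h1, self_mem_nhdsWithin] with u hu hne hmem
  exact hu ⟨hmem, hne⟩

lemma analyticAt_wp {u : ℂ} (hu : u ∉ Λ.lattice) : AnalyticAt ℂ (wp Λ) u :=
  Λ.analyticOnNhd_weierstrassP u hu

lemma analyticAt_wp' {u : ℂ} (hu : u ∉ Λ.lattice) : AnalyticAt ℂ (wp' Λ) u :=
  Λ.analyticOnNhd_derivWeierstrassP u hu

lemma analyticAt_wp'' {u : ℂ} (hu : u ∉ Λ.lattice) : AnalyticAt ℂ (wp'' Λ) u :=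
  (analyticAt_wp' Λ hu).deriv

lemma hasDerivAt_wp {u : ℂ} (hu : u ∉ Λ.lattice) : HasDerivAt (wp Λ) (wp' Λ u) u := by
  have := (analyticAt_wp Λ hu).differentiableAt.hasDerivAt
  rwa [Λ.deriv_weierstrassP] at this

lemma hasDerivAt_wp' {u : ℂ} (hu : u ∉ Λ.lattice) : HasDerivAt (wp' Λ) (wp'' Λ u) u :=
  (analyticAt_wp' Λ hu).differentiableAt.hasDerivAt

variable {Λ} in
lemma wp_add {u l : ℂ} (hl : l ∈ Λ.lattice) : wp Λ (u + l) = wp Λ u :=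
  Λ.weierstrassP_add_coe u ⟨l, hl⟩

variable {Λ} in
lemma wp'_add {u l : ℂ} (hl : l ∈ Λ.lattice) : wp' Λ (u + l) = wp' Λ u :=
  Λ.derivWeierstrassP_add_coe u ⟨l, hl⟩

variable {Λ} in
lemma wp''_add {u l : ℂ} (hl : l ∈ Λ.lattice) : wp'' Λ (u + l) = wp'' Λ u := by
  have h : (fun u => wp' Λ (u + l)) = wp' Λ := funext fun u => wp'_add hl
  rw [wp'', ← deriv_comp_add_const, h]

lemma wp''_neg (u : ℂ) : wp'' Λ (-u) = wp'' Λ u := by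
  have h : (fun u => wp' Λ (-u)) = fun u => -wp' Λ u := funext fun u => Λ.derivWeierstrassP_neg u
  have h1 := deriv_comp_neg (wp' Λ) u
  rw [h, deriv.fun_neg] at h1
  exact (neg_injective h1).symm

/-- The principal parts of `℘`, `℘'` and `℘''` at a lattice point. -/
lemma exists_principalPart {l : ℂ} (hl : l ∈ Λ.lattice) :
    ∃ A : ℂ → ℂ, AnalyticAt ℂ A l ∧ ∀ᶠ u in 𝓝[≠] l,
      wp Λ u = ((u - l) ^ 2)⁻¹ + A u ∧ wp' Λ u = -2 * ((u - l) ^ 3)⁻¹ + deriv A u ∧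
        wp'' Λ u = 6 * ((u - l) ^ 4)⁻¹ + deriv (deriv A) u := by
  let A : ℂ → ℂ := fun u => Λ.weierstrassPExcept l u - 1 / l ^ 2
  have hA : AnalyticAt ℂ A l := (Λ.analyticAt_weierstrassPExcept l).sub analyticAt_const
  have h0 (u : ℂ) : wp Λ u = ((u - l) ^ 2)⁻¹ + A u := by
    rw [wp, ← Λ.weierstrassPExcept_add ⟨l, hl⟩ u]
    simp only [A]
    ring
  have hne : ∀ᶠ u in 𝓝[≠] l, u ≠ l := self_mem_nhdsWithin
  have hmem := eventually_notMem_lattice Λ l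
  have hAn : ∀ᶠ u in 𝓝[≠] l, AnalyticAt ℂ A u :=
    nhdsWithin_le_nhds hA.eventually_analyticAt
  have h1 : ∀ᶠ u in 𝓝[≠] l, wp' Λ u = -2 * ((u - l) ^ 3)⁻¹ + deriv A u := by
    filter_upwards [hne, hmem, hAn] with u hu hu' hAu
    have hs : u - l ≠ 0 := sub_ne_zero.2 hu
    have h2 : HasDerivAt (fun u => ((u - l) ^ 2)⁻¹ + A u)
        (-(2 * (u - l)) / ((u - l) ^ 2) ^ 2 + deriv A u) u := by
      refine HasDerivAt.add (HasDerivAt.fun_inv ?_ (pow_ne_zero _ hs))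
        hAu.differentiableAt.hasDerivAt
      simpa using ((hasDerivAt_id u).sub_const l).fun_pow 2
    have h3 := hasDerivAt_wp Λ hu'
    rw [funext h0] at h3
    rw [h3.unique h2]
    field_simp
  refine ⟨A, hA, ?_⟩
  have h1' := eventually_eventually_nhdsWithin.2 h1
  filter_upwards [hne, hmem, hAn, h1, h1'] with u hu hu' hAu hu1 hu1'
  refine ⟨h0 u, hu1, ?_⟩
  have hs : u - l ≠ 0 := sub_ne_zero.2 hu
  have h2 : HasDerivAt (fun u => -2 * ((u - l) ^ 3)⁻¹ + deriv A u)
      (-2 * (-(3 * (u - l) ^ 2) / ((u - l) ^ 3) ^ 2) + deriv (deriv A) u) u := by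
    refine HasDerivAt.add (HasDerivAt.const_mul _ (HasDerivAt.fun_inv ?_ (pow_ne_zero _ hs)))
      hAu.deriv.differentiableAt.hasDerivAt
    simpa using ((hasDerivAt_id u).sub_const l).fun_pow 3
  have h3 : HasDerivAt (wp' Λ)
      (-2 * (-(3 * (u - l) ^ 2) / ((u - l) ^ 3) ^ 2) + deriv (deriv A) u) u := by
    refine h2.congr_of_eventuallyEq ?_
    rwa [isOpen_compl_singleton.nhdsWithin_eq hu] at hu1'
  rw [(hasDerivAt_wp' Λ hu').unique h3]
  field_simp
  ring

/-- At a lattice point `l`, the coefficient of `(u - l)⁻²` in `℘` is `1`. -/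
lemma tendsto_sq_mul_wp {l : ℂ} (hl : l ∈ Λ.lattice) :
    Tendsto (fun u => (u - l) ^ 2 * wp Λ u) (𝓝[≠] l) (𝓝 1) := by
  obtain ⟨A, hA, hAe⟩ := exists_principalPart Λ hl
  have h1 : Tendsto (fun u => 1 + (u - l) ^ 2 * A u) (𝓝 l) (𝓝 (1 + (l - l) ^ 2 * A l)) :=
    ContinuousAt.tendsto (by have := hA.continuousAt; fun_prop)
  simp only [sub_self, ne_eq, OfNat.ofNat_ne_zero, not_false_eq_true, zero_pow, zero_mul,
    add_zero] at h1
  refine (h1.mono_left nhdsWithin_le_nhds).congr' ?_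
  filter_upwards [hAe, self_mem_nhdsWithin] with u hu hne
  have hs : u - l ≠ 0 := sub_ne_zero.2 hne
  rw [hu.1]
  field_simp

lemma isPreconnected_compl_lattice : IsPreconnected ((Λ.lattice : Set ℂ)ᶜ) :=
  ((countable_lattice Λ).isConnected_compl_of_one_lt_rank (by simp)).isPreconnected

/-- The differential equation `℘'' = 6 ℘² - g₂ / 2`, obtained by differentiating the one for
`℘'²` and cancelling `℘'`. -/
lemma wp''_eq {u : ℂ} (hu : u ∉ Λ.lattice) : wp'' Λ u = 6 * wp Λ u ^ 2 - Λ.g₂ / 2 := by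
  have hprod : ∀ v ∈ (Λ.lattice : Set ℂ)ᶜ,
      wp' Λ v * (wp'' Λ v - 6 * wp Λ v ^ 2 + Λ.g₂ / 2) = 0 := by
    intro v hv
    have h1 := (hasDerivAt_wp' Λ hv).fun_pow 2
    have h2 := ((((hasDerivAt_wp Λ hv).fun_pow 3).const_mul 4).sub
      ((hasDerivAt_wp Λ hv).const_mul Λ.g₂)).sub_const Λ.g₃
    have h3 := h1.congr_of_eventuallyEq (f₁ := fun v => 4 * wp Λ v ^ 3 - Λ.g₂ * wp Λ v - Λ.g₃) (by
      filter_upwards [(isOpen_compl_lattice Λ).mem_nhds hv] with x hx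
      exact (Λ.derivWeierstrassP_sq x hx).symm)
    have h4 := h3.unique h2
    norm_num at h4
    linear_combination h4 / 2
  have hor := AnalyticOnNhd.eq_zero_or_eq_zero_of_mul_eq_zero
    (fun v hv => analyticAt_wp' Λ hv)
    (fun v hv => ((analyticAt_wp'' Λ hv).sub (analyticAt_const.mul
      ((analyticAt_wp Λ hv).pow 2))).add analyticAt_const) hprod (isPreconnected_compl_lattice Λ)
  rcases hor with h | h
  · -- `℘' = 0` is incompatible with the pole of `℘'` at the origin
    exfalso
    obtain ⟨A, hA, hAe⟩ := exists_principalPart Λ (zero_mem Λ.lattice)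
    have h1 : Tendsto (fun u => u ^ 3 * deriv A u) (𝓝[≠] 0) (𝓝 (0 ^ 3 * deriv A 0)) :=
      ContinuousAt.tendsto (by have := hA.deriv.continuousAt; fun_prop) |>.mono_left
        nhdsWithin_le_nhds
    have h2 : Tendsto (fun u => u ^ 3 * deriv A u) (𝓝[≠] 0) (𝓝 2) := by
      refine tendsto_const_nhds.congr' ?_
      filter_upwards [hAe, self_mem_nhdsWithin, eventually_notMem_lattice Λ 0] with u hu hne hmem
      have h3 := hu.2.1
      rw [h u hmem, sub_zero] at h3
      have hs : u ≠ 0 := hne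
      field_simp at h3
      linear_combination h3
    have := tendsto_nhds_unique h1 h2
    norm_num at this
  · have h1 : wp'' Λ u - 6 * wp Λ u ^ 2 + Λ.g₂ / 2 = 0 := h u hu
    linear_combination h1

lemma hasDerivAt_wp'' {u : ℂ} (hu : u ∉ Λ.lattice) :
    HasDerivAt (wp'' Λ) (12 * wp Λ u * wp' Λ u) u := by
  have h1 := (((hasDerivAt_wp Λ hu).fun_pow 2).const_mul 6).sub_const (Λ.g₂ / 2)
  have h2 := h1.congr_of_eventuallyEq (f₁ := wp'' Λ) (by
    filter_upwards [(isOpen_compl_lattice Λ).mem_nhds hu] with x hx using wp''_eq Λ hx)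
  exact h2.congr_deriv (by push_cast; ring)

variable {Λ} in
/-- A point of the elliptic curve is determined by the values of `℘` and `℘'`: the translates
`℘(u + a)` and `℘(u + b)` solve `y'' = 6 y² - g₂ / 2` with the same initial values at `u = 0`, hence
agree, and so have the same poles. -/
lemma sub_mem_lattice_of_wp_eq {a b : ℂ} (ha : a ∉ Λ.lattice) (hb : b ∉ Λ.lattice)
    (h : wp Λ a = wp Λ b) (h' : wp' Λ a = wp' Λ b) : a - b ∈ Λ.lattice := by
  by_contra hab
  have hnear {c : ℂ} (hc : c ∉ Λ.lattice) : ∀ᶠ u in 𝓝 (0 : ℂ), u + c ∉ Λ.lattice := by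
    have : ContinuousAt (fun u : ℂ => u + c) 0 := by fun_prop
    exact this.eventually_mem ((isOpen_compl_lattice Λ).mem_nhds (by simpa using hc))
  have han {c : ℂ} (hc : c ∉ Λ.lattice) : AnalyticAt ℂ (fun u => wp Λ (u + c)) 0 :=
    AnalyticAt.comp_of_eq (analyticAt_wp Λ hc) (f := fun u => u + c)
      (analyticAt_id.add analyticAt_const) (by simp)
  have han' {c : ℂ} (hc : c ∉ Λ.lattice) : AnalyticAt ℂ (fun u => wp' Λ (u + c)) 0 :=
    AnalyticAt.comp_of_eq (analyticAt_wp' Λ hc) (f := fun u => u + c)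
      (analyticAt_id.add analyticAt_const) (by simp)
  have hD := (han ha).fun_sub (han hb)
  have hD' := (han' ha).fun_sub (han' hb)
  -- the difference of the two solutions vanishes to every order at the origin
  have hord : ∀ n : ℕ, (n : ℕ∞) ≤ analyticOrderAt (fun u => wp Λ (u + a) - wp Λ (u + b)) 0 := by
    intro n
    induction n with
    | zero => simp
    | succ n ih =>
      have h2 : (n : ℕ∞) ≤ analyticOrderAt (fun u => wp'' Λ (u + a) - wp'' Λ (u + b)) 0 := by
        have h3 : (fun u => wp'' Λ (u + a) - wp'' Λ (u + b)) =ᶠ[𝓝 0]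
            (fun u => 6 * (wp Λ (u + a) + wp Λ (u + b))) *
              fun u => wp Λ (u + a) - wp Λ (u + b) := by
          filter_upwards [hnear ha, hnear hb] with u hua hub
          rw [wp''_eq Λ hua, wp''_eq Λ hub, Pi.mul_apply]
          ring
        rw [analyticOrderAt_congr h3,
          analyticOrderAt_mul (analyticAt_const.fun_mul ((han ha).fun_add (han hb))) hD]
        exact ih.trans le_add_self
      have h4 := succ_le_analyticOrderAt hD' (by simp [h']) (by
        filter_upwards [hnear ha, hnear hb] with u hua hub
        exact ((hasDerivAt_wp' Λ hua).comp_add_const u a).sub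
          ((hasDerivAt_wp' Λ hub).comp_add_const u b)) h2
      have h5 := succ_le_analyticOrderAt hD (by simp [h]) (by
        filter_upwards [hnear ha, hnear hb] with u hua hub
        exact ((hasDerivAt_wp Λ hua).comp_add_const u a).sub
          ((hasDerivAt_wp Λ hub).comp_add_const u b)) h4
      exact le_trans (by exact_mod_cast Nat.le_succ _) h5
  have hzero : ∀ᶠ u in 𝓝 (0 : ℂ), wp Λ (u + a) - wp Λ (u + b) = 0 :=
    analyticOrderAt_eq_top.1 (ENat.eq_top_iff_forall_ge.2 hord)
  -- hence `℘` and its translate agree wherever both are analytic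
  set c := a - b with hc
  let S : Set ℂ := (Λ.lattice : Set ℂ) ∪ (fun u => u + c) '' Λ.lattice
  have hS : S.Countable := (countable_lattice Λ).union ((countable_lattice Λ).image _)
  have hSconn : IsPreconnected Sᶜ :=
    (hS.isConnected_compl_of_one_lt_rank (by simp)).isPreconnected
  have hSmem {u : ℂ} (hu : u ∉ Λ.lattice) (hu' : u - c ∉ Λ.lattice) : u ∈ Sᶜ := by
    rintro (h | ⟨v, hv, rfl⟩)
    · exact hu h
    · exact hu' (by simpa using hv)
  have hSmem' {u : ℂ} (hu : u ∈ Sᶜ) : u ∉ Λ.lattice ∧ u - c ∉ Λ.lattice :=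
    ⟨fun h => hu (Or.inl h), fun h => hu (Or.inr ⟨u - c, h, by simp⟩)⟩
  have hanc {u : ℂ} (hu : u - c ∉ Λ.lattice) : AnalyticAt ℂ (fun u => wp Λ (u - c)) u :=
    AnalyticAt.comp_of_eq (analyticAt_wp Λ hu) (f := fun u => u - c)
      (analyticAt_id.sub analyticAt_const) rfl
  have heq : Set.EqOn (wp Λ) (fun u => wp Λ (u - c)) Sᶜ := by
    refine AnalyticOnNhd.eqOn_of_preconnected_of_eventuallyEq (z₀ := a)
      (fun u hu => analyticAt_wp Λ (hSmem' hu).1) (fun u hu => hanc (hSmem' hu).2) hSconn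
      (hSmem ha (by simpa [hc] using hb)) ?_
    have h6 : Tendsto (fun u => u - a) (𝓝 a) (𝓝 0) := by
      have : ContinuousAt (fun u : ℂ => u - a) a := by fun_prop
      simpa [ContinuousAt] using this
    filter_upwards [h6.eventually hzero] with u hu
    have h7 : u - a + b = u - c := by rw [hc]; ring
    rwa [sub_add_cancel, h7, sub_eq_zero] at hu
  have hc0 : (0 : ℂ) - c ∉ Λ.lattice := by simpa using hab
  have h8 : Tendsto (fun u => (u - 0) ^ 2 * wp Λ (u - c)) (𝓝[≠] 0)
      (𝓝 ((0 - 0) ^ 2 * wp Λ (0 - c))) :=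
    ContinuousAt.tendsto (by have := (hanc hc0).continuousAt; fun_prop) |>.mono_left
      nhdsWithin_le_nhds
  have h9 : Tendsto (fun u => (u - 0) ^ 2 * wp Λ (u - c)) (𝓝[≠] 0) (𝓝 1) := by
    refine (tendsto_sq_mul_wp Λ (zero_mem Λ.lattice)).congr' ?_
    have h10 : ∀ᶠ u in 𝓝[≠] (0 : ℂ), u - c ∉ Λ.lattice := by
      have : ContinuousAt (fun u : ℂ => u - c) 0 := by fun_prop
      exact nhdsWithin_le_nhds (this.eventually_mem ((isOpen_compl_lattice Λ).mem_nhds hc0))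
    filter_upwards [eventually_notMem_lattice Λ 0, h10] with u hu hu'
    rw [heq (hSmem hu hu')]
  have := tendsto_nhds_unique h8 h9
  norm_num at this

variable {Λ} in
lemma wp'_half {l : ℂ} (hl : l ∈ Λ.lattice) : wp' Λ (l / 2) = 0 := by
  have h1 : wp' Λ (-(l / 2) + l) = wp' Λ (-(l / 2)) := wp'_add hl
  have h2 : -(l / 2) + l = l / 2 := by ring
  rw [h2, wp', Λ.derivWeierstrassP_neg] at h1
  exact self_eq_neg.1 h1

lemma half_add_notMem_lattice : (Λ.ω₁ + Λ.ω₂) / 2 ∉ Λ.lattice := by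
  have := (Λ.mul_ω₁_add_mul_ω₂_mem_lattice (α := 1 / 2) (β := 1 / 2)).not.mpr (by norm_num)
  convert this using 2
  push_cast
  ring

lemma half_sub_notMem_lattice : Λ.ω₁ / 2 - Λ.ω₂ / 2 ∉ Λ.lattice := by
  intro h
  apply half_add_notMem_lattice Λ
  have := add_mem h Λ.ω₂_mem_lattice
  convert this using 1
  ring

lemma wp_half_ne : wp Λ (Λ.ω₁ / 2) ≠ wp Λ (Λ.ω₂ / 2) := fun h =>
  half_sub_notMem_lattice Λ (sub_mem_lattice_of_wp_eq Λ.ω₁_div_two_notMem_lattice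
    Λ.ω₂_div_two_notMem_lattice h
    (by rw [wp'_half Λ.ω₁_mem_lattice, wp'_half Λ.ω₂_mem_lattice]))

lemma wp_half_cubic {l : ℂ} (hl : l ∈ Λ.lattice) (hl2 : l / 2 ∉ Λ.lattice) :
    4 * wp Λ (l / 2) ^ 3 - Λ.g₂ * wp Λ (l / 2) - Λ.g₃ = 0 := by
  rw [wp, ← Λ.derivWeierstrassP_sq _ hl2, ← wp', wp'_half hl]
  norm_num

/-- The discriminant of the lattice does not vanish, because the values of `℘` at the three half
periods are distinct roots of `4 x³ - g₂ x - g₃`. -/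
lemma discriminant_ne_zero : Λ.g₂ ^ 3 - 27 * Λ.g₃ ^ 2 ≠ 0 := by
  have hs := add_mem Λ.ω₁_mem_lattice Λ.ω₂_mem_lattice
  have h12 := wp_half_ne Λ
  have h13 : wp Λ (Λ.ω₁ / 2) ≠ wp Λ ((Λ.ω₁ + Λ.ω₂) / 2) := fun h => by
    have := sub_mem_lattice_of_wp_eq Λ.ω₁_div_two_notMem_lattice (half_add_notMem_lattice Λ) h
      (by rw [wp'_half Λ.ω₁_mem_lattice, wp'_half hs])
    have h2 := neg_mem this
    exact Λ.ω₂_div_two_notMem_lattice (by convert h2 using 1; ring)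
  have h23 : wp Λ (Λ.ω₂ / 2) ≠ wp Λ ((Λ.ω₁ + Λ.ω₂) / 2) := fun h => by
    have := sub_mem_lattice_of_wp_eq Λ.ω₂_div_two_notMem_lattice (half_add_notMem_lattice Λ) h
      (by rw [wp'_half Λ.ω₂_mem_lattice, wp'_half hs])
    have h2 := neg_mem this
    exact Λ.ω₁_div_two_notMem_lattice (by convert h2 using 1; ring)
  have c1 := wp_half_cubic Λ Λ.ω₁_mem_lattice Λ.ω₁_div_two_notMem_lattice
  have c2 := wp_half_cubic Λ Λ.ω₂_mem_lattice Λ.ω₂_div_two_notMem_lattice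
  have c3 := wp_half_cubic Λ hs (half_add_notMem_lattice Λ)
  generalize wp Λ (Λ.ω₁ / 2) = x at *
  generalize wp Λ (Λ.ω₂ / 2) = y at *
  generalize wp Λ ((Λ.ω₁ + Λ.ω₂) / 2) = z at *
  have hg2 : Λ.g₂ = 4 * (x ^ 2 + x * y + y ^ 2) := by
    apply mul_left_cancel₀ (sub_ne_zero.2 h12)
    linear_combination c2 - c1
  have hg2' : Λ.g₂ = 4 * (x ^ 2 + x * z + z ^ 2) := by
    apply mul_left_cancel₀ (sub_ne_zero.2 h13)
    linear_combination c3 - c1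
  have hz : z = -x - y := by
    apply mul_left_cancel₀ (sub_ne_zero.2 h23)
    linear_combination (hg2' - hg2) / 4
  have hg3 : Λ.g₃ = 4 * x ^ 3 - Λ.g₂ * x := by linear_combination -c1
  have : Λ.g₂ ^ 3 - 27 * Λ.g₃ ^ 2 = 16 * ((x - y) * (x - z) * (y - z)) ^ 2 := by
    rw [hg3, hg2, hz]
    ring
  rw [this]
  exact mul_ne_zero (by norm_num) (pow_ne_zero _ (mul_ne_zero
    (mul_ne_zero (sub_ne_zero.2 h12) (sub_ne_zero.2 h13)) (sub_ne_zero.2 h23)))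

end

/-! ### Liouville theorems for elliptic functions -/

/-- A `Λ`-periodic function of one variable, holomorphic off `Λ` and with poles of order at most `m`
on `Λ`. As values at individual points are disregarded, being holomorphic at a point means
agreeing on a punctured neighbourhood with a function analytic at that point. -/
structure EllipticPoleLE (Λ : PeriodPair) (m : ℕ) (f : ℂ → ℂ) : Prop where
  periodic : ∀ u l, l ∈ Λ.lattice → f (u + l) = f u
  regular : ∀ u₀, ∃ h : ℂ → ℂ, AnalyticAt ℂ h u₀ ∧
    ∀ᶠ u in 𝓝[≠] u₀, h u = localEquation Λ m u₀ u * f u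

variable {Λ : PeriodPair}

lemma localEquation_of_mem {m : ℕ} {u₀ : ℂ} (h : u₀ ∈ Λ.lattice) (u : ℂ) :
    localEquation Λ m u₀ u = (u - u₀) ^ m := if_pos h

lemma localEquation_of_notMem {m : ℕ} {u₀ : ℂ} (h : u₀ ∉ Λ.lattice) (u : ℂ) :
    localEquation Λ m u₀ u = 1 := if_neg h

/-- The behaviour on `Λ` has to be checked only at the origin. -/
lemma EllipticPoleLE.of_zero {m : ℕ} {f : ℂ → ℂ}
    (hper : ∀ u l, l ∈ Λ.lattice → f (u + l) = f u)
    (hoff : ∀ u₀, u₀ ∉ Λ.lattice → ∃ h : ℂ → ℂ, AnalyticAt ℂ h u₀ ∧ ∀ᶠ u in 𝓝[≠] u₀, h u = f u)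
    (hzero : ∃ h : ℂ → ℂ, AnalyticAt ℂ h 0 ∧ ∀ᶠ u in 𝓝[≠] (0 : ℂ), h u = u ^ m * f u) :
    EllipticPoleLE Λ m f := by
  refine ⟨hper, fun u₀ => ?_⟩
  by_cases hu : u₀ ∈ Λ.lattice
  · obtain ⟨h, hh, he⟩ := hzero
    refine ⟨fun u => h (u - u₀), hh.comp_of_eq (f := fun u => u - u₀)
      (analyticAt_id.sub analyticAt_const) (sub_self _), ?_⟩
    have ht : Tendsto (fun u => u - u₀) (𝓝[≠] u₀) (𝓝[≠] 0) := by
      refine tendsto_nhdsWithin_iff.2 ⟨?_, ?_⟩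
      · have : ContinuousAt (fun u => u - u₀) u₀ := by fun_prop
        simpa [ContinuousAt] using this.tendsto.mono_left (nhdsWithin_le_nhds (s := {u₀}ᶜ))
      · filter_upwards [self_mem_nhdsWithin] with u hne using sub_ne_zero.2 hne
    filter_upwards [ht.eventually he] with u hu'
    rw [hu', localEquation_of_mem hu, sub_eq_add_neg u u₀, hper _ _ (neg_mem hu)]
  · obtain ⟨h, hh, he⟩ := hoff u₀ hu
    exact ⟨h, hh, by simpa [localEquation_of_notMem hu] using he⟩

lemma EllipticPoleLE.regular_of_notMem {m : ℕ} {f : ℂ → ℂ} (hf : EllipticPoleLE Λ m f) {u₀ : ℂ}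
    (hu : u₀ ∉ Λ.lattice) : ∃ h : ℂ → ℂ, AnalyticAt ℂ h u₀ ∧ ∀ᶠ u in 𝓝[≠] u₀, h u = f u := by
  simpa [localEquation_of_notMem hu] using hf.regular u₀

lemma EllipticPoleLE.regular_zero {m : ℕ} {f : ℂ → ℂ} (hf : EllipticPoleLE Λ m f) :
    ∃ h : ℂ → ℂ, AnalyticAt ℂ h 0 ∧ ∀ᶠ u in 𝓝[≠] (0 : ℂ), h u = u ^ m * f u := by
  simpa [localEquation_of_mem (zero_mem Λ.lattice)] using hf.regular 0

/-- Liouville: an elliptic function without poles is constant. -/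
lemma EllipticPoleLE.eq_const_of_zero {f : ℂ → ℂ} (hf : EllipticPoleLE Λ 0 f) :
    ∃ c, ∀ u₀, ∀ᶠ u in 𝓝[≠] u₀, f u = c := by
  have hreg (u₀ : ℂ) : ∃ h : ℂ → ℂ, AnalyticAt ℂ h u₀ ∧ ∀ᶠ u in 𝓝[≠] u₀, h u = f u := by
    simpa [localEquation] using hf.regular u₀
  -- removing the singularities
  let F : ℂ → ℂ := fun u => limUnder (𝓝[≠] u) f
  have hFlim {h : ℂ → ℂ} {v : ℂ} (hh : ContinuousAt h v) (he : ∀ᶠ u in 𝓝[≠] v, h u = f u) :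
      F v = h v :=
    ((hh.tendsto.mono_left nhdsWithin_le_nhds).congr' he).limUnder_eq
  have hF {u₀ : ℂ} {h : ℂ → ℂ} (hh : AnalyticAt ℂ h u₀) (he : ∀ᶠ u in 𝓝[≠] u₀, h u = f u) :
      ∀ᶠ u in 𝓝 u₀, F u = h u := by
    have he' := eventually_nhdsWithin_iff.1 (eventually_eventually_nhdsWithin.2 he)
    filter_upwards [he', hh.eventually_analyticAt] with v hv hhv
    by_cases hne : v = u₀
    · subst hne
      exact hFlim hh.continuousAt he
    · have := hv hne
      rw [isOpen_compl_singleton.nhdsWithin_eq hne] at this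
      exact hFlim hhv.continuousAt (nhdsWithin_le_nhds this)
  have hFan (u₀ : ℂ) : AnalyticAt ℂ F u₀ := by
    obtain ⟨h, hh, he⟩ := hreg u₀
    exact hh.congr ((hF hh he).mono fun _ h => h.symm)
  have hFper (z w : ℂ) (hw : w ∈ Λ.lattice) : F (z + w) = F z := by
    obtain ⟨h, hh, he⟩ := hreg (z + w)
    rw [hFlim hh.continuousAt he]
    symm
    have hc : ContinuousAt (fun u => h (u + w)) z :=
      hh.continuousAt.comp (f := fun u => u + w) (by fun_prop)
    refine hFlim hc ?_
    have ht : Tendsto (fun u => u + w) (𝓝[≠] z) (𝓝[≠] (z + w)) := by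
      refine tendsto_nhdsWithin_iff.2 ⟨?_, ?_⟩
      · have : ContinuousAt (fun u => u + w) z := by fun_prop
        exact this.tendsto.mono_left nhdsWithin_le_nhds
      · filter_upwards [self_mem_nhdsWithin] with u hne
        simpa using hne
    filter_upwards [ht.eventually he] with u hu
    rw [hu, hf.periodic _ _ hw]
  have hFd : Differentiable ℂ F := fun u => (hFan u).differentiableAt
  have hFb := (IsZLattice.isCompact_range_of_periodic Λ.lattice F hFd.continuous hFper).isBounded
  refine ⟨F 0, fun u₀ => ?_⟩
  obtain ⟨h, hh, he⟩ := hreg u₀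
  filter_upwards [he, nhdsWithin_le_nhds (hF hh he)] with u hu hu'
  rw [← hu, ← hu', hFd.apply_eq_apply_of_bounded hFb u 0]

lemma exists_analyticAt_eq_mul {h : ℂ → ℂ} (hh : AnalyticAt ℂ h 0) (h0 : h 0 = 0) :
    ∃ k : ℂ → ℂ, AnalyticAt ℂ k 0 ∧ ∀ᶠ u in 𝓝 (0 : ℂ), h u = u * k u := by
  have h1 : ((1 : ℕ) : ℕ∞) ≤ analyticOrderAt h 0 := by
    rw [Nat.cast_one, Order.one_le_iff_ne_zero]
    exact hh.analyticOrderAt_ne_zero.2 h0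
  simpa using (natCast_le_analyticOrderAt hh).1 h1

lemma analyticAt_comp_neg {h : ℂ → ℂ} {u₀ : ℂ} (hh : AnalyticAt ℂ h (-u₀)) :
    AnalyticAt ℂ (fun u => h (-u)) u₀ :=
  hh.comp_of_eq (f := fun u => -u) analyticAt_id.neg rfl

lemma tendsto_neg_punctured (u₀ : ℂ) : Tendsto (fun u => -u) (𝓝[≠] u₀) (𝓝[≠] (-u₀)) := by
  refine tendsto_nhdsWithin_iff.2 ⟨?_, ?_⟩
  · exact continuousAt_neg.tendsto.mono_left nhdsWithin_le_nhds
  · filter_upwards [self_mem_nhdsWithin] with u hne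
    simpa using hne

/-- The even part of an analytic function has no linear term. -/
lemma exists_add_comp_neg_eq_add_sq_mul {h : ℂ → ℂ} (hh : AnalyticAt ℂ h 0) :
    ∃ k : ℂ → ℂ, AnalyticAt ℂ k 0 ∧ ∀ᶠ u in 𝓝 (0 : ℂ), h u + h (-u) = 2 * h 0 + u ^ 2 * k u := by
  have hh0 : AnalyticAt ℂ h (-0) := by simpa using hh
  have hneg := analyticAt_comp_neg hh0
  have hE : AnalyticAt ℂ (fun u => h u + h (-u) - 2 * h 0) 0 :=
    (hh.fun_add hneg).fun_sub analyticAt_const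
  have hdan : AnalyticAt ℂ (fun u => deriv h u - deriv h (-u)) 0 :=
    hh.deriv.fun_sub (analyticAt_comp_neg hh0.deriv)
  have h1 : ((1 : ℕ) : ℕ∞) ≤ analyticOrderAt (fun u => deriv h u - deriv h (-u)) 0 := by
    rw [Nat.cast_one, Order.one_le_iff_ne_zero]
    exact hdan.analyticOrderAt_ne_zero.2 (by simp)
  have hd : ∀ᶠ u in 𝓝 (0 : ℂ), HasDerivAt (fun u => h u + h (-u) - 2 * h 0)
      (deriv h u - deriv h (-u)) u := by
    have hn : Tendsto (fun u : ℂ => -u) (𝓝 0) (𝓝 0) := by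
      simpa using (continuous_neg (G := ℂ)).tendsto 0
    filter_upwards [hh.eventually_analyticAt, hn.eventually hh.eventually_analyticAt] with u h1 h2
    have h3 := h2.differentiableAt.hasDerivAt.comp u (hasDerivAt_neg u)
    have h4 := (h1.differentiableAt.hasDerivAt.add h3).sub_const (2 * h 0)
    exact h4.congr_deriv (by ring)
  have h2 := succ_le_analyticOrderAt hE (by simp; ring) hd h1
  obtain ⟨k, hk, hke⟩ := (natCast_le_analyticOrderAt hE).1 h2
  refine ⟨k, hk, hke.mono fun u hu => ?_⟩
  simp only [sub_zero, smul_eq_mul] at hu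
  linear_combination hu

/-- An elliptic function with at most one simple pole is constant. If `c` is the residue of `f`
and `o u = f u - f (-u)`, then `o ^ 2 - 4 * c ^ 2 * ℘` has no pole, so it is constant. As `o`
vanishes at the half periods, where `℘` takes different values, `c = 0`. -/
lemma EllipticPoleLE.eq_const_of_one {f : ℂ → ℂ} (hf : EllipticPoleLE Λ 1 f) :
    ∃ c, ∀ u₀, ∀ᶠ u in 𝓝[≠] u₀, f u = c := by
  obtain ⟨h, hh, he⟩ := hf.regular_zero
  simp only [pow_one] at he
  set c := h 0 with hc
  have hpneg (u l : ℂ) (hl : l ∈ Λ.lattice) : f (-(u + l)) = f (-u) := by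
    rw [neg_add, hf.periodic _ _ (neg_mem hl)]
  have hoff (u₀ : ℂ) (hu : u₀ ∉ Λ.lattice) : ∃ H : ℂ → ℂ, AnalyticAt ℂ H u₀ ∧
      ∀ᶠ u in 𝓝[≠] u₀, H u = f u - f (-u) := by
    obtain ⟨H₁, hH₁, he₁⟩ := hf.regular_of_notMem hu
    obtain ⟨H₂, hH₂, he₂⟩ := hf.regular_of_notMem (u₀ := -u₀) (by simpa using hu)
    refine ⟨fun u => H₁ u - H₂ (-u), hH₁.fun_sub (analyticAt_comp_neg hH₂), ?_⟩
    filter_upwards [he₁, (tendsto_neg_punctured u₀).eventually he₂] with u h1 h2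
    rw [h1, h2]
  have hsq : EllipticPoleLE Λ 0 fun u => (f u - f (-u)) ^ 2 - 4 * c ^ 2 * wp Λ u := by
    refine .of_zero (fun u l hl => ?_) (fun u₀ hu => ?_) ?_
    · rw [hf.periodic _ _ hl, hpneg _ _ hl, wp_add hl]
    · obtain ⟨H, hH, hHe⟩ := hoff u₀ hu
      refine ⟨fun u => H u ^ 2 - 4 * c ^ 2 * wp Λ u,
        (hH.fun_pow 2).fun_sub (analyticAt_const.fun_mul (analyticAt_wp Λ hu)), ?_⟩
      filter_upwards [hHe] with u h1
      rw [h1]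
    · obtain ⟨k, hk, hke⟩ := exists_add_comp_neg_eq_add_sq_mul hh
      obtain ⟨A, hA, hAe⟩ := exists_principalPart Λ (zero_mem Λ.lattice)
      refine ⟨fun u => 4 * c * k u + u ^ 2 * k u ^ 2 - 4 * c ^ 2 * A u, by fun_prop, ?_⟩
      have hneg := (tendsto_neg_punctured 0).eventually (by simpa using he)
      filter_upwards [he, hneg, nhdsWithin_le_nhds hke, hAe, self_mem_nhdsWithin] with
        u h1 h2 h3 h4 hne
      have hu : u ≠ 0 := hne
      have ho : f u - f (-u) = (2 * c + u ^ 2 * k u) / u := by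
        rw [eq_div_iff hu, ← h3, h1, h2]
        ring
      rw [ho, h4.1, sub_zero]
      field_simp
      ring
  obtain ⟨d, hd⟩ := hsq.eq_const_of_zero
  have hhalf {l : ℂ} (hl : l ∈ Λ.lattice) (hl2 : l / 2 ∉ Λ.lattice) :
      -(4 * c ^ 2 * wp Λ (l / 2)) = d := by
    obtain ⟨H, hH, hHe⟩ := hoff _ hl2
    -- reflection in the half period
    have ht : Tendsto (fun u => l - u) (𝓝[≠] (l / 2)) (𝓝[≠] (l / 2)) := by
      refine tendsto_nhdsWithin_iff.2 ⟨?_, ?_⟩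
      · have h1 : ContinuousAt (fun u => l - u) (l / 2) := by fun_prop
        have h2 := h1.tendsto.mono_left (nhdsWithin_le_nhds (s := {l / 2}ᶜ))
        rwa [sub_half] at h2
      · filter_upwards [self_mem_nhdsWithin] with u hne h
        apply hne
        have h' : l - u = l / 2 := h
        change u = l / 2
        linear_combination -h'
    have hH1 : Tendsto H (𝓝[≠] (l / 2)) (𝓝 (H (l / 2))) :=
      hH.continuousAt.tendsto.mono_left nhdsWithin_le_nhds
    have hH2 : Tendsto H (𝓝[≠] (l / 2)) (𝓝 (-H (l / 2))) := by
      refine (hH1.comp ht).neg.congr' ?_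
      filter_upwards [hHe, ht.eventually hHe] with u h1 h2
      have e1 : f (l - u) = f (-u) := by
        rw [sub_eq_add_neg, add_comm, hf.periodic _ _ hl]
      have e2 : f (-(l - u)) = f u := by
        rw [neg_sub, sub_eq_add_neg, hf.periodic _ _ (neg_mem hl)]
      rw [Function.comp_apply, h2, h1, e1, e2, neg_sub]
    have hH0 : H (l / 2) = 0 := self_eq_neg.1 (tendsto_nhds_unique hH1 hH2)
    have hwp : Tendsto (wp Λ) (𝓝[≠] (l / 2)) (𝓝 (wp Λ (l / 2))) :=
      (analyticAt_wp Λ hl2).continuousAt.tendsto.mono_left nhdsWithin_le_nhds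
    have hlim := (hH1.pow 2).sub (hwp.const_mul (4 * c ^ 2))
    rw [hH0] at hlim
    have hlim' : Tendsto (fun u => H u ^ 2 - 4 * c ^ 2 * wp Λ u) (𝓝[≠] (l / 2)) (𝓝 d) := by
      refine tendsto_const_nhds.congr' ?_
      filter_upwards [hd (l / 2), hHe] with u h1 h2
      rw [h2, h1]
    have := tendsto_nhds_unique hlim hlim'
    linear_combination this
  have hc0 : c = 0 := by
    have h1 := hhalf Λ.ω₁_mem_lattice Λ.ω₁_div_two_notMem_lattice
    have h2 := hhalf Λ.ω₂_mem_lattice Λ.ω₂_div_two_notMem_lattice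
    have h3 : c ^ 2 * (wp Λ (Λ.ω₁ / 2) - wp Λ (Λ.ω₂ / 2)) = 0 := by
      linear_combination (h2 - h1) / 4
    rcases mul_eq_zero.1 h3 with h4 | h4
    · exact pow_eq_zero_iff two_ne_zero |>.1 h4
    · exact absurd (sub_eq_zero.1 h4) (wp_half_ne Λ)
  obtain ⟨k, hk, hke⟩ := exists_analyticAt_eq_mul hh (hc ▸ hc0)
  refine (EllipticPoleLE.of_zero (m := 0) hf.periodic (fun u₀ hu => hf.regular_of_notMem hu)
    ⟨k, hk, ?_⟩).eq_const_of_zero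
  filter_upwards [he, nhdsWithin_le_nhds hke, self_mem_nhdsWithin] with u h1 h2 hne
  rw [pow_zero, one_mul]
  exact mul_left_cancel₀ hne (h2.symm.trans h1)

/-- An elliptic function with at most one double pole is an affine function of `℘`. -/
lemma EllipticPoleLE.eq_affine_wp_of_two {f : ℂ → ℂ} (hf : EllipticPoleLE Λ 2 f) :
    ∃ α β, ∀ u₀, ∀ᶠ u in 𝓝[≠] u₀, f u = α + β * wp Λ u := by
  obtain ⟨h, hh, he⟩ := hf.regular_zero
  obtain ⟨k, hk, hke⟩ := exists_analyticAt_eq_mul (h := fun u => h u - h 0)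
    (hh.fun_sub analyticAt_const) (sub_self _)
  have h1 : EllipticPoleLE Λ 1 fun u => f u - h 0 * wp Λ u := by
    refine .of_zero (fun u l hl => ?_) (fun u₀ hu => ?_) ?_
    · rw [hf.periodic _ _ hl, wp_add hl]
    · obtain ⟨H, hH, hHe⟩ := hf.regular_of_notMem hu
      refine ⟨fun u => H u - h 0 * wp Λ u,
        hH.fun_sub (analyticAt_const.fun_mul (analyticAt_wp Λ hu)), ?_⟩
      filter_upwards [hHe] with u h1
      rw [h1]
    · obtain ⟨A, hA, hAe⟩ := exists_principalPart Λ (zero_mem Λ.lattice)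
      refine ⟨fun u => k u - h 0 * u * A u, by fun_prop, ?_⟩
      filter_upwards [he, nhdsWithin_le_nhds hke, hAe, self_mem_nhdsWithin] with u h1 h2 h3 hne
      have hu : u ≠ 0 := hne
      rw [h3.1, sub_zero]
      have h4 : f u = h u / u ^ 2 := by
        rw [eq_div_iff (pow_ne_zero _ hu), h1]
        ring
      have h5 : h u = h 0 + u * k u := by linear_combination h2
      rw [h4, h5]
      field_simp
      ring
  obtain ⟨c, hc⟩ := h1.eq_const_of_one
  exact ⟨c, h 0, fun u₀ => (hc u₀).mono fun u hu => by linear_combination hu⟩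

/-! ### The spaces `L(a, b, c)` -/

variable (Λ) in
lemma exists_analyticAt_eq_mul_wpRow (i : Fin 4) (u₀ : ℂ) : ∃ h : ℂ → ℂ, AnalyticAt ℂ h u₀ ∧
    ∀ᶠ u in 𝓝 u₀, u ∉ Λ.lattice → h u = localEquation Λ 4 u₀ u * wpRow Λ u i := by
  by_cases hu : u₀ ∈ Λ.lattice
  · obtain ⟨A, hA, hAe⟩ := exists_principalPart Λ hu
    have hA' := hA.deriv
    have hA'' := hA.deriv.deriv
    have hev := eventually_nhdsWithin_iff.1 hAe
    refine ⟨fun u => ![(u - u₀) ^ 4, (u - u₀) ^ 2 + (u - u₀) ^ 4 * A u,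
      -2 * (u - u₀) + (u - u₀) ^ 4 * deriv A u, 6 + (u - u₀) ^ 4 * deriv (deriv A) u] i, ?_, ?_⟩
    · fin_cases i <;> simp <;> fun_prop
    · filter_upwards [hev] with u h1 h2
      have hne : u ≠ u₀ := fun h => h2 (h ▸ hu)
      have hs : u - u₀ ≠ 0 := sub_ne_zero.2 hne
      obtain ⟨e0, e1, e2⟩ := h1 hne
      rw [localEquation_of_mem hu]
      fin_cases i
      · simp [wpRow]
      · simp only [wpRow, Fin.mk_one, Matrix.cons_val_one, Matrix.cons_val_zero, e0]
        field_simp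
      · simp only [wpRow, Fin.reduceFinMk, Matrix.cons_val, e1]
        field_simp
      · simp only [wpRow, Fin.reduceFinMk, Matrix.cons_val, e2]
        field_simp
  · refine ⟨fun u => wpRow Λ u i, ?_, by simp [localEquation_of_notMem hu]⟩
    have h0 := analyticAt_wp Λ hu
    have h1 := analyticAt_wp' Λ hu
    have h2 := analyticAt_wp'' Λ hu
    fin_cases i
    · simpa [wpRow] using analyticAt_const
    · simpa [wpRow] using h0
    · simpa [wpRow] using h1
    · simpa [wpRow] using h2

lemma wpRow_eq_of_sub_mem {u v : ℂ} (h : v - u ∈ Λ.lattice) : wpRow Λ v = wpRow Λ u := by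
  have hv : v = u + (v - u) := by ring
  rw [hv]
  simp only [wpRow, wp_add h, wp'_add h, wp''_add h]

variable (Λ) in
lemma productSpace_le_poleSpace : productSpace Λ 1 1 1 ≤ poleSpace Λ 4 4 4 := by
  refine Submodule.span_le.2 ?_
  rintro f ⟨i, j, k, rfl⟩
  refine ⟨fun q q' h1 h2 => ?_, fun p => ?_⟩
  · have h3 : (q'.1.1 - q'.1.2) - (q.1.1 - q.1.2) ∈ Λ.lattice := by
      convert sub_mem h1 h2 using 1
      ring
    simp only [restrict, wpRow_eq_of_sub_mem h1, wpRow_eq_of_sub_mem h2, wpRow_eq_of_sub_mem h3]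
  · obtain ⟨h₁, ha₁, he₁⟩ := exists_analyticAt_eq_mul_wpRow Λ (i 0) p.1
    obtain ⟨h₂, ha₂, he₂⟩ := exists_analyticAt_eq_mul_wpRow Λ (j 0) p.2
    obtain ⟨h₃, ha₃, he₃⟩ := exists_analyticAt_eq_mul_wpRow Λ (k 0) (p.1 - p.2)
    refine ⟨fun q => h₁ q.1 * h₂ q.2 * h₃ (q.1 - q.2), ?_, ?_⟩
    · refine (AnalyticAt.fun_mul ?_ ?_).fun_mul ?_
      · exact ha₁.comp_of_eq analyticAt_fst rfl
      · exact ha₂.comp_of_eq analyticAt_snd rfl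
      · exact ha₃.comp_of_eq (f := fun q : ℂ × ℂ => q.1 - q.2)
          (analyticAt_fst.sub analyticAt_snd) rfl
    · have t₃ : ContinuousAt (fun q : ℂ × ℂ => q.1 - q.2) p := by fun_prop
      filter_upwards [continuousAt_fst.eventually he₁, continuousAt_snd.eventually he₂,
        t₃.eventually he₃] with q e₁ e₂ e₃ hq
      rw [e₁ hq.1, e₂ hq.2.1, e₃ hq.2.2]
      simp only [restrict, divisorEquation, Finset.univ_unique, Fin.default_eq_zero,
        Finset.prod_singleton]
      ring

lemma eventually_notMem_lattice_of_continuousAt {X : Type*} [TopologicalSpace X] {g : X → ℂ} {x : X}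
    (hg : ContinuousAt g x) (hx : g x ∉ Λ.lattice) : ∀ᶠ y in 𝓝 x, g y ∉ Λ.lattice :=
  hg.eventually_mem ((isOpen_compl_lattice Λ).mem_nhds hx)

/-- Points near `(l, w)` on the horizontal line through it lie off the divisors. -/
lemma eventually_mem_offDivisors {l w : ℂ} (hl : l ∈ Λ.lattice) (hw : w ∉ Λ.lattice) :
    ∀ᶠ z in 𝓝[≠] l, (z, w) ∈ offDivisors Λ := by
  have h1 : l - w ∉ Λ.lattice := fun h => hw (by simpa using sub_mem hl h)
  have h2 : ∀ᶠ z in 𝓝 l, z - w ∉ Λ.lattice :=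
    eventually_notMem_lattice_of_continuousAt (g := fun z => z - w) (by fun_prop) h1
  filter_upwards [eventually_notMem_lattice Λ l, nhdsWithin_le_nhds h2] with z h3 h4
  exact ⟨h3, hw, h4⟩

lemma tendsto_prodMk_punctured (l w : ℂ) : Tendsto (fun z => (z, w)) (𝓝[≠] l) (𝓝 (l, w)) := by
  have : ContinuousAt (fun z : ℂ => (z, w)) l := by fun_prop
  exact this.tendsto.mono_left nhdsWithin_le_nhds

/-- Behaviour of an element of `L(a, b, c)` along `z = 0`, away from the other divisors. -/
lemma exists_analyticAt_eq_pow_mul {F : ℂ → ℂ → ℂ} {a b c : ℕ}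
    (hF : restrict Λ F ∈ poleSpace Λ a b c) {w : ℂ} (hw : w ∉ Λ.lattice) :
    ∃ h : ℂ × ℂ → ℂ, AnalyticAt ℂ h (0, w) ∧ ∀ᶠ q in 𝓝 ((0 : ℂ), w),
      q ∈ offDivisors Λ → h q = q.1 ^ a * F q.1 q.2 := by
  obtain ⟨h, hh, he⟩ := hF.2 (0, w)
  refine ⟨h, hh, he.mono fun q hq hqo => ?_⟩
  have hw' : -w ∉ Λ.lattice := by simpa using hw
  rw [hq hqo]
  simp [divisorEquation, localEquation_of_mem (zero_mem Λ.lattice), localEquation_of_notMem hw,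
    localEquation_of_notMem hw', restrict]

lemma tendsto_of_eventually_eq {F : ℂ → ℂ → ℂ} {h : ℂ × ℂ → ℂ} {a : ℕ} {w : ℂ}
    (hw : w ∉ Λ.lattice) (hh : ContinuousAt h (0, w))
    (he : ∀ᶠ q in 𝓝 ((0 : ℂ), w), q ∈ offDivisors Λ → h q = q.1 ^ a * F q.1 q.2) :
    Tendsto (fun z => z ^ a * F z w) (𝓝[≠] 0) (𝓝 (h (0, w))) := by
  refine (hh.tendsto.comp (tendsto_prodMk_punctured 0 w)).congr' ?_
  filter_upwards [(tendsto_prodMk_punctured 0 w).eventually he,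
    eventually_mem_offDivisors (zero_mem Λ.lattice) hw] with z h1 h2
  exact h1 h2

lemma localEquation_continuous (m : ℕ) (u₀ : ℂ) : Continuous (localEquation Λ m u₀) := by
  unfold localEquation
  split_ifs <;> fun_prop

/-- The order of the pole along `z = 0` drops as soon as it drops on every generic line `w = const`.
At the points where several of the divisors meet, this uses the divisibility of analytic functions
that vanish on `z = const`. -/
lemma mem_poleSpace_of_tendsto {F : ℂ → ℂ → ℂ} {a b c : ℕ}
    (hF : restrict Λ F ∈ poleSpace Λ (a + 1) b c)
    (h0 : ∀ w, w ∉ Λ.lattice → Tendsto (fun z => z ^ (a + 1) * F z w) (𝓝[≠] 0) (𝓝 0)) :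
    restrict Λ F ∈ poleSpace Λ a b c := by
  refine ⟨hF.1, fun p => ?_⟩
  obtain ⟨h, hh, he⟩ := hF.2 p
  by_cases hp : p.1 ∈ Λ.lattice
  swap
  · refine ⟨h, hh, ?_⟩
    simpa only [divisorEquation, localEquation_of_notMem hp] using he
  obtain ⟨l, w₀⟩ := p
  dsimp only at hp
  have hgen : ∀ w, w ∉ Λ.lattice → ContinuousAt h (l, w) →
      (∀ᶠ q in 𝓝 (l, w), ∀ hq : q ∈ offDivisors Λ,
        h q = divisorEquation Λ (a + 1) b c (l, w₀) q * restrict Λ F ⟨q, hq⟩) →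
      h (l, w) = 0 := by
    intro w hw hc hev
    have h1 : Tendsto (fun z => h (z, w)) (𝓝[≠] l) (𝓝 (h (l, w))) :=
      hc.tendsto.comp (tendsto_prodMk_punctured l w)
    have ht : Tendsto (fun z => z - l) (𝓝[≠] l) (𝓝[≠] 0) := by
      refine tendsto_nhdsWithin_iff.2 ⟨?_, ?_⟩
      · have : ContinuousAt (fun z => z - l) l := by fun_prop
        simpa [ContinuousAt] using this.tendsto.mono_left (nhdsWithin_le_nhds (s := {l}ᶜ))
      · filter_upwards [self_mem_nhdsWithin] with z hne using sub_ne_zero.2 hne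
    have hcont : Continuous fun q : ℂ × ℂ =>
        localEquation Λ b w₀ q.2 * localEquation Λ c (l - w₀) (q.1 - q.2) :=
      ((localEquation_continuous b w₀).comp continuous_snd).mul
        ((localEquation_continuous c (l - w₀)).comp (continuous_fst.sub continuous_snd))
    have h2 := ((h0 w hw).comp ht).mul
      ((hcont.tendsto (l, w)).comp (tendsto_prodMk_punctured l w))
    rw [zero_mul] at h2
    refine tendsto_nhds_unique h1 (h2.congr' ?_)
    filter_upwards [(tendsto_prodMk_punctured l w).eventually hev,
      eventually_mem_offDivisors hp hw] with z h3 h4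
    have h5 : (z - l, w) ∈ offDivisors Λ :=
      ⟨fun h => h4.1 (by simpa using add_mem h hp), hw,
        fun h => h4.2.2 (by convert add_mem h hp using 1; ring)⟩
    have h6 : F z w = F (z - l) w :=
      hF.1 ⟨(z - l, w), h5⟩ ⟨(z, w), h4⟩ (by simpa using hp) (by simp)
    rw [h3 h4]
    simp only [Function.comp_apply, divisorEquation, restrict, localEquation_of_mem hp, h6]
    ring
  have hvan : ∀ᶠ w in 𝓝 w₀, h (l, w) = 0 := by
    have hline (w : ℂ) : ContinuousAt (fun w : ℂ => (l, w)) w := by fun_prop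
    have hev := (hline w₀).eventually
      (he.eventually_nhds.and (hh.eventually_analyticAt.mono fun q hq => hq.continuousAt))
    filter_upwards [hev.eventually_nhds, hev] with w h1 h2
    have h3 : Tendsto (fun w' => h (l, w')) (𝓝[≠] w) (𝓝 (h (l, w))) :=
      (h2.2.comp (hline w)).tendsto.mono_left nhdsWithin_le_nhds
    refine tendsto_nhds_unique h3 (tendsto_const_nhds.congr' ?_)
    filter_upwards [eventually_notMem_lattice Λ w, nhdsWithin_le_nhds h1] with w' h4 h5
    exact (hgen w' h4 h5.2 h5.1).symm
  obtain ⟨k, hk, hke⟩ := exists_analyticAt_eq_sub_mul hh hvan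
  refine ⟨k, hk, ?_⟩
  filter_upwards [he, hke] with q h1 h2 hq
  have hne : q.1 - l ≠ 0 := sub_ne_zero.2 fun h => hq.1 (h ▸ hp)
  apply mul_left_cancel₀ hne
  rw [← h2, h1 hq]
  simp only [divisorEquation, localEquation_of_mem hp]
  ring

lemma localEquation_neg (m : ℕ) (u₀ : ℂ) : ∃ ε : ℂ, ∀ u,
    localEquation Λ m u₀ u = ε * localEquation Λ m (-u₀) (-u) := by
  by_cases h : u₀ ∈ Λ.lattice
  · refine ⟨(-1) ^ m, fun u => ?_⟩
    rw [localEquation_of_mem h, localEquation_of_mem (neg_mem h), ← mul_pow]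
    ring
  · refine ⟨1, fun u => ?_⟩
    rw [localEquation_of_notMem h, localEquation_of_notMem (by simpa using h), one_mul]

/-- The automorphism `(z, w) ↦ (-w, -z)` interchanges the first two divisors. -/
lemma mem_poleSpace_comp_neg_swap {F : ℂ → ℂ → ℂ} {a b c : ℕ}
    (hF : restrict Λ F ∈ poleSpace Λ a b c) :
    restrict Λ (fun z w => F (-w) (-z)) ∈ poleSpace Λ b a c := by
  have hmem {q : ℂ × ℂ} (hq : q ∈ offDivisors Λ) : (-q.2, -q.1) ∈ offDivisors Λ :=
    ⟨by simpa using hq.2.1, by simpa using hq.1, by convert hq.2.2 using 2; simp; ring⟩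
  refine ⟨fun q q' h1 h2 => ?_, fun p => ?_⟩
  · refine hF.1 ⟨_, hmem q.2⟩ ⟨_, hmem q'.2⟩ ?_ ?_
    · convert neg_mem h2 using 1; ring
    · convert neg_mem h1 using 1; ring
  · obtain ⟨h, hh, he⟩ := hF.2 (-p.2, -p.1)
    obtain ⟨ε₁, h₁⟩ := localEquation_neg (Λ := Λ) b p.1
    obtain ⟨ε₂, h₂⟩ := localEquation_neg (Λ := Λ) a p.2
    refine ⟨fun q => ε₁ * ε₂ * h (-q.2, -q.1), analyticAt_const.fun_mul
      (hh.comp_of_eq (f := fun q : ℂ × ℂ => (-q.2, -q.1))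
        (analyticAt_snd.neg.prod analyticAt_fst.neg) rfl), ?_⟩
    have ht : ContinuousAt (fun q : ℂ × ℂ => (-q.2, -q.1)) p := by fun_prop
    filter_upwards [ht.eventually he] with q h3 hq
    rw [h3 (hmem hq)]
    simp only [divisorEquation, restrict, h₁, h₂, neg_sub_neg]
    ring

/-- The automorphism `(z, w) ↦ (w - z, w)` interchanges the first and the third divisor. -/
lemma mem_poleSpace_comp_sub {F : ℂ → ℂ → ℂ} {a b c : ℕ}
    (hF : restrict Λ F ∈ poleSpace Λ a b c) :
    restrict Λ (fun z w => F (w - z) w) ∈ poleSpace Λ c b a := by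
  have hmem {q : ℂ × ℂ} (hq : q ∈ offDivisors Λ) : (q.2 - q.1, q.2) ∈ offDivisors Λ := by
    refine ⟨fun h => hq.2.2 ?_, hq.2.1, by simpa using hq.1⟩
    simpa using neg_mem h
  refine ⟨fun q q' h1 h2 => ?_, fun p => ?_⟩
  · refine hF.1 ⟨_, hmem q.2⟩ ⟨_, hmem q'.2⟩ ?_ h2
    convert sub_mem h2 h1 using 1; ring
  · obtain ⟨h, hh, he⟩ := hF.2 (p.2 - p.1, p.2)
    obtain ⟨ε₁, h₁⟩ := localEquation_neg (Λ := Λ) c p.1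
    obtain ⟨ε₂, h₂⟩ := localEquation_neg (Λ := Λ) a (p.1 - p.2)
    refine ⟨fun q => ε₁ * ε₂ * h (q.2 - q.1, q.2), analyticAt_const.fun_mul
      (hh.comp_of_eq (f := fun q : ℂ × ℂ => (q.2 - q.1, q.2))
        ((analyticAt_snd.sub analyticAt_fst).prod analyticAt_snd) rfl), ?_⟩
    have ht : ContinuousAt (fun q : ℂ × ℂ => (q.2 - q.1, q.2)) p := by fun_prop
    filter_upwards [ht.eventually he] with q h3 hq
    rw [h3 (hmem hq)]
    simp only [divisorEquation, restrict, h₁, h₂, neg_sub, sub_sub_cancel_left]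
    ring

/-! ### The functions `F₁` and `F₂`: products, symmetries and residues -/

variable (Λ) in
lemma wpRow_mul_mem_productSpace (i j k : Fin 4) :
    restrict Λ (fun z w => wpRow Λ z i * wpRow Λ w j * wpRow Λ (z - w) k) ∈
      productSpace Λ 1 1 1 :=
  Submodule.subset_span ⟨fun _ => i, fun _ => j, fun _ => k, by simp⟩

variable (Λ) in
lemma f₁_mem_productSpace : restrict Λ (f₁ Λ) ∈ productSpace Λ 1 1 1 := by
  have T := wpRow_mul_mem_productSpace Λ
  convert sub_mem (sub_mem (T 2 0 0) (T 0 2 0)) (T 0 0 2) using 1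
  ext q
  simp [restrict, f₁, wpRow]

variable (Λ) in
lemma f₂_mem_productSpace : restrict Λ (f₂ Λ) ∈ productSpace Λ 1 1 1 := by
  have T := wpRow_mul_mem_productSpace Λ
  convert add_mem (sub_mem (add_mem (add_mem (sub_mem (T 1 2 0) (T 2 1 0)) (T 0 2 1)) (T 0 1 2))
    (T 2 0 1)) (T 1 0 2) using 1
  ext q
  simp [restrict, f₂, wpRow]

variable (Λ) in
lemma f₃_mem_productSpace : restrict Λ (f₃ Λ) ∈ productSpace Λ 1 1 1 := by
  have T := wpRow_mul_mem_productSpace Λ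
  convert add_mem (sub_mem (add_mem (add_mem (sub_mem (T 3 2 0) (T 2 3 0)) (T 0 2 3)) (T 0 3 2))
    (T 2 0 3)) (T 3 0 2) using 1
  ext q
  simp [restrict, f₃, wpRow]

variable (Λ) in
lemma f₄_mem_productSpace : restrict Λ (f₄ Λ) ∈ productSpace Λ 1 1 1 := by
  have T := wpRow_mul_mem_productSpace Λ
  convert add_mem (sub_mem (T 1 1 2) (T 2 1 1)) (T 1 2 1) using 1
  ext q
  simp [restrict, f₄, wpRow]

variable (Λ) in
lemma f₅_mem_productSpace : restrict Λ (f₅ Λ) ∈ productSpace Λ 1 1 1 := by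
  have T := wpRow_mul_mem_productSpace Λ
  convert add_mem (add_mem (sub_mem (sub_mem (add_mem (T 1 3 2) (T 3 1 2)) (T 2 3 1)) (T 2 1 3))
    (T 3 2 1)) (T 1 2 3) using 1
  ext q
  simp [restrict, f₅, wpRow]

variable (Λ) in
lemma f₇_mem_productSpace : restrict Λ (f₇ Λ) ∈ productSpace Λ 1 1 1 :=
  wpRow_mul_mem_productSpace Λ 2 2 2

variable (Λ) in
lemma F₁_mem_productSpace : restrict Λ (F₁ Λ) ∈ productSpace Λ 1 1 1 :=
  sub_mem (sub_mem (f₃_mem_productSpace Λ) (Submodule.smul_mem _ 30 (f₄_mem_productSpace Λ)))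
    (Submodule.smul_mem _ (5 / 2 * Λ.g₂) (f₁_mem_productSpace Λ))

variable (Λ) in
lemma F₂_mem_productSpace : restrict Λ (F₂ Λ) ∈ productSpace Λ 1 1 1 :=
  add_mem (sub_mem (sub_mem (Submodule.smul_mem _ 2 (f₅_mem_productSpace Λ))
    (Submodule.smul_mem _ 9 (f₇_mem_productSpace Λ)))
      (Submodule.smul_mem _ (5 * Λ.g₂) (f₂_mem_productSpace Λ)))
        (Submodule.smul_mem _ (15 * Λ.g₃) (f₁_mem_productSpace Λ))

lemma wp_neg (u : ℂ) : wp Λ (-u) = wp Λ u := Λ.weierstrassP_neg u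

lemma wp'_neg (u : ℂ) : wp' Λ (-u) = -wp' Λ u := Λ.derivWeierstrassP_neg u

variable (Λ) in
lemma F₁_neg_swap : (fun z w => F₁ Λ (-w) (-z)) = F₁ Λ := by
  ext z w
  simp only [F₁, f₁, f₃, f₄, wp_neg, wp'_neg, wp''_neg, neg_sub_neg]
  ring

variable (Λ) in
lemma F₂_neg_swap : (fun z w => F₂ Λ (-w) (-z)) = F₂ Λ := by
  ext z w
  simp only [F₂, f₁, f₂, f₅, f₇, wp_neg, wp'_neg, wp''_neg, neg_sub_neg]
  ring

variable (Λ) in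
lemma F₁_sub : (fun z w => F₁ Λ (w - z) w) = F₁ Λ := by
  ext z w
  rw [← neg_sub z w]
  simp only [F₁, f₁, f₃, f₄, wp_neg, wp'_neg, wp''_neg, neg_sub, sub_sub_cancel_left]
  rw [← neg_sub z w]
  simp only [wp_neg, wp'_neg, wp''_neg]
  ring

variable (Λ) in
lemma F₂_sub : (fun z w => F₂ Λ (w - z) w) = F₂ Λ := by
  ext z w
  simp only [F₂, f₁, f₂, f₅, f₇, wp_neg, wp'_neg, wp''_neg, sub_sub_cancel_left]
  rw [← neg_sub z w]
  simp only [wp_neg, wp'_neg, wp''_neg]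
  ring

/-- Taylor's formula to third order, the derivatives being given by explicit functions. -/
lemma exists_eq_taylor {f f₁ f₂ f₃ : ℂ → ℂ} (hf : AnalyticAt ℂ f 0) (hf₁ : AnalyticAt ℂ f₁ 0)
    (hf₂ : AnalyticAt ℂ f₂ 0) (hf₃ : AnalyticAt ℂ f₃ 0)
    (h₁ : ∀ᶠ z in 𝓝 0, HasDerivAt f (f₁ z) z) (h₂ : ∀ᶠ z in 𝓝 0, HasDerivAt f₁ (f₂ z) z)
    (h₃ : ∀ᶠ z in 𝓝 0, HasDerivAt f₂ (f₃ z) z) :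
    ∃ r : ℂ → ℂ, AnalyticAt ℂ r 0 ∧ ∀ᶠ z in 𝓝 (0 : ℂ),
      f z = f 0 + f₁ 0 * z + f₂ 0 / 2 * z ^ 2 + f₃ 0 / 6 * z ^ 3 + z ^ 4 * r z := by
  have hp (n : ℕ) (z : ℂ) : HasDerivAt (fun z : ℂ => z ^ n) (n * z ^ (n - 1)) z :=
    hasDerivAt_pow n z
  have o₃ : ((1 : ℕ) : ℕ∞) ≤ analyticOrderAt (fun z => f₃ z - f₃ 0) 0 := by
    rw [Nat.cast_one, Order.one_le_iff_ne_zero]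
    exact (hf₃.fun_sub analyticAt_const).analyticOrderAt_ne_zero.2 (sub_self _)
  have o₂ := succ_le_analyticOrderAt (f := fun z => f₂ z - (f₂ 0 + f₃ 0 * z))
    (by fun_prop) (by simp) (h₃.mono fun z h => by
      refine (h.sub (((hasDerivAt_id z).const_mul (f₃ 0)).const_add (f₂ 0))).congr_deriv ?_
      ring) o₃
  have o₁ := succ_le_analyticOrderAt (f := fun z => f₁ z - (f₁ 0 + f₂ 0 * z + f₃ 0 / 2 * z ^ 2))
    (by fun_prop) (by simp) (h₂.mono fun z h => by
      refine (h.sub ((((hasDerivAt_id z).const_mul (f₂ 0)).const_add (f₁ 0)).add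
        ((hp 2 z).const_mul (f₃ 0 / 2)))).congr_deriv ?_
      push_cast
      ring) o₂
  have o₀ := succ_le_analyticOrderAt
    (f := fun z => f z - (f 0 + f₁ 0 * z + f₂ 0 / 2 * z ^ 2 + f₃ 0 / 6 * z ^ 3))
    (by fun_prop) (by simp) (h₁.mono fun z h => by
      refine (h.sub (((((hasDerivAt_id z).const_mul (f₁ 0)).const_add (f 0)).add
        ((hp 2 z).const_mul (f₂ 0 / 2))).add ((hp 3 z).const_mul (f₃ 0 / 6)))).congr_deriv ?_
      push_cast
      ring) o₁
  obtain ⟨r, hr, he⟩ := (natCast_le_analyticOrderAt (by fun_prop)).1 o₀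
  refine ⟨r, hr, he.mono fun z hz => ?_⟩
  simp only [sub_zero, smul_eq_mul] at hz
  linear_combination hz

/-- The expansions of `℘(z - w)`, `℘'(z - w)` and `℘''(z - w)` in powers of `z`, with coefficients
expressed by `℘(w)`, `℘'(w)` and `℘''(w)` by means of `℘''' = 12 ℘ ℘'`. -/
lemma exists_taylor_wp_sub {w : ℂ} (hw : w ∉ Λ.lattice) :
    ∃ r₀ r₁ r₂ : ℂ → ℂ, ContinuousAt r₀ 0 ∧ ContinuousAt r₁ 0 ∧ ContinuousAt r₂ 0 ∧
      ∀ᶠ z in 𝓝 (0 : ℂ),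
        wp Λ (z - w) = wp Λ w - wp' Λ w * z + wp'' Λ w / 2 * z ^ 2
          - 2 * wp Λ w * wp' Λ w * z ^ 3 + z ^ 4 * r₀ z ∧
        wp' Λ (z - w) = -wp' Λ w + wp'' Λ w * z - 6 * wp Λ w * wp' Λ w * z ^ 2
          + 2 * (wp' Λ w ^ 2 + wp Λ w * wp'' Λ w) * z ^ 3 + z ^ 4 * r₁ z ∧
        wp'' Λ (z - w) = wp'' Λ w - 12 * wp Λ w * wp' Λ w * z
          + 6 * (wp' Λ w ^ 2 + wp Λ w * wp'' Λ w) * z ^ 2 + z ^ 3 * r₂ z := by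
  have hw' : (0 : ℂ) - w ∉ Λ.lattice := by simpa using hw
  have hsub : AnalyticAt ℂ (fun z => z - w) 0 := analyticAt_id.sub analyticAt_const
  have a₀ : AnalyticAt ℂ (fun z => wp Λ (z - w)) 0 :=
    AnalyticAt.comp_of_eq (analyticAt_wp Λ hw') hsub rfl
  have a₁ : AnalyticAt ℂ (fun z => wp' Λ (z - w)) 0 :=
    AnalyticAt.comp_of_eq (g := wp' Λ) (analyticAt_wp' Λ hw') hsub rfl
  have a₂ : AnalyticAt ℂ (fun z => wp'' Λ (z - w)) 0 :=
    AnalyticAt.comp_of_eq (analyticAt_wp'' Λ hw') hsub rfl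
  have hev : ∀ᶠ z in 𝓝 (0 : ℂ), z - w ∉ Λ.lattice :=
    eventually_notMem_lattice_of_continuousAt (g := fun z => z - w) (by fun_prop) hw'
  have d₀ : ∀ᶠ z in 𝓝 (0 : ℂ), HasDerivAt (fun z => wp Λ (z - w)) (wp' Λ (z - w)) z :=
    hev.mono fun z hz => (hasDerivAt_wp Λ hz).comp_sub_const z w
  have d₁ : ∀ᶠ z in 𝓝 (0 : ℂ), HasDerivAt (fun z => wp' Λ (z - w)) (wp'' Λ (z - w)) z :=
    hev.mono fun z hz => (hasDerivAt_wp' Λ hz).comp_sub_const z w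
  have d₂ : ∀ᶠ z in 𝓝 (0 : ℂ), HasDerivAt (fun z => wp'' Λ (z - w))
      (12 * wp Λ (z - w) * wp' Λ (z - w)) z :=
    hev.mono fun z hz => (hasDerivAt_wp'' Λ hz).comp_sub_const z w
  have d₃ : ∀ᶠ z in 𝓝 (0 : ℂ), HasDerivAt (fun z => 12 * wp Λ (z - w) * wp' Λ (z - w))
      (12 * (wp' Λ (z - w) ^ 2 + wp Λ (z - w) * wp'' Λ (z - w))) z := by
    filter_upwards [d₀, d₁] with z h₀ h₁
    exact ((h₀.const_mul 12).mul h₁).congr_deriv (by ring)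
  have d₄ : ∀ᶠ z in 𝓝 (0 : ℂ), HasDerivAt
      (fun z => 12 * (wp' Λ (z - w) ^ 2 + wp Λ (z - w) * wp'' Λ (z - w)))
      (36 * wp' Λ (z - w) * wp'' Λ (z - w) + 144 * wp Λ (z - w) ^ 2 * wp' Λ (z - w)) z := by
    filter_upwards [d₀, d₁, d₂] with z h₀ h₁ h₂
    refine (((h₁.fun_pow 2).add (h₀.mul h₂)).const_mul 12).congr_deriv ?_
    push_cast
    ring
  obtain ⟨r₀, hr₀, e₀⟩ := exists_eq_taylor a₀ a₁ a₂ (by fun_prop) d₀ d₁ d₂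
  obtain ⟨r₁, hr₁, e₁⟩ := exists_eq_taylor a₁ a₂ (by fun_prop) (by fun_prop) d₁ d₂ d₃
  obtain ⟨r₂, hr₂, e₂⟩ := exists_eq_taylor a₂ (by fun_prop) (by fun_prop) (by fun_prop) d₂ d₃ d₄
  refine ⟨r₀, r₁, fun z => (-36 * wp' Λ w * wp'' Λ w - 144 * wp Λ w ^ 2 * wp' Λ w) / 6 + z * r₂ z,
    hr₀.continuousAt, hr₁.continuousAt, by have := hr₂.continuousAt; fun_prop, ?_⟩
  simp only [zero_sub, wp_neg, wp'_neg, wp''_neg] at e₀ e₁ e₂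
  filter_upwards [e₀, e₁, e₂] with z h₀ h₁ h₂
  refine ⟨?_, ?_, ?_⟩
  · rw [h₀]; ring
  · rw [h₁]; ring
  · rw [h₂]; ring

/-- Only the principal parts of `℘`, `℘'` and `℘''` at the origin contribute to a residue. -/
lemma tendsto_mul_of_principalPart {f c₀ c₁ c₂ c₃ g : ℂ → ℂ} {R : ℂ}
    (hc₀ : ContinuousAt c₀ 0) (hc₁ : ContinuousAt c₁ 0) (hc₂ : ContinuousAt c₂ 0)
    (hc₃ : ContinuousAt c₃ 0) (hg : ContinuousAt g 0)
    (hf : ∀ z, f z = c₂ z * wp'' Λ z + c₁ z * wp' Λ z + c₀ z * wp Λ z + c₃ z)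
    (hG : ∀ᶠ z in 𝓝 (0 : ℂ), 6 * c₂ z - 2 * z * c₁ z + z ^ 2 * c₀ z = R * z ^ 3 + z ^ 4 * g z) :
    Tendsto (fun z => z * f z) (𝓝[≠] 0) (𝓝 R) := by
  obtain ⟨A, hA, hAe⟩ := exists_principalPart Λ (zero_mem Λ.lattice)
  have hA₀ := hA.continuousAt
  have hA₁ := hA.deriv.continuousAt
  have hA₂ := hA.deriv.deriv.continuousAt
  have h1 : ContinuousAt (fun z => R + z * (g z + c₂ z * deriv (deriv A) z + c₁ z * deriv A z
      + c₀ z * A z + c₃ z)) 0 := by fun_prop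
  have h2 := h1.tendsto.mono_left (nhdsWithin_le_nhds (s := {0}ᶜ))
  rw [zero_mul, add_zero] at h2
  refine h2.congr' ?_
  filter_upwards [hAe, nhdsWithin_le_nhds hG, self_mem_nhdsWithin] with z h3 h4 hne
  have hz : z ≠ 0 := hne
  have h5 : R + z * g z = (6 * c₂ z - 2 * z * c₁ z + z ^ 2 * c₀ z) / z ^ 3 := by
    rw [h4]
    field_simp
  rw [hf, h3.1, h3.2.1, h3.2.2]
  simp only [sub_zero]
  have h6 : R + z * (g z + c₂ z * deriv (deriv A) z + c₁ z * deriv A z + c₀ z * A z + c₃ z) =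
      (6 * c₂ z - 2 * z * c₁ z + z ^ 2 * c₀ z) / z ^ 3 +
        z * (c₂ z * deriv (deriv A) z + c₁ z * deriv A z + c₀ z * A z + c₃ z) := by
    rw [← h5]
    ring
  rw [h6]
  field_simp
  ring

lemma tendsto_mul_F₁ {w : ℂ} (hw : w ∉ Λ.lattice) :
    Tendsto (fun z => z * F₁ Λ z w) (𝓝[≠] 0) (𝓝 (-36 * Λ.g₂ * wp Λ w - 54 * Λ.g₃)) := by
  obtain ⟨r₀, r₁, r₂, hr₀, hr₁, hr₂, he⟩ := exists_taylor_wp_sub hw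
  have hw' : (0 : ℂ) - w ∉ Λ.lattice := by simpa using hw
  have hV : ContinuousAt (fun z => wp Λ (z - w)) 0 :=
    ContinuousAt.comp_of_eq (analyticAt_wp Λ hw').continuousAt (by fun_prop) rfl
  have hW : ContinuousAt (fun z => wp' Λ (z - w)) 0 :=
    ContinuousAt.comp_of_eq (g := wp' Λ) (analyticAt_wp' Λ hw').continuousAt (by fun_prop) rfl
  have hS : ContinuousAt (fun z => wp'' Λ (z - w)) 0 :=
    ContinuousAt.comp_of_eq (analyticAt_wp'' Λ hw').continuousAt (by fun_prop) rfl
  have hD := wp''_eq Λ hw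
  have hQ : wp' Λ w ^ 2 = 4 * wp Λ w ^ 3 - Λ.g₂ * wp Λ w - Λ.g₃ := Λ.derivWeierstrassP_sq w hw
  -- `c₂`, `c₁`, `c₀`, `c₃` are the coefficients of `℘''(z)`, `℘'(z)`, `℘(z)` and `1`; `g` collects
  -- what the remainders and the higher Taylor coefficients contribute
  refine tendsto_mul_of_principalPart (Λ := Λ)
    (c₂ := fun z => wp' Λ w + wp' Λ (z - w))
    (c₁ := fun z => -wp'' Λ w - wp'' Λ (z - w) + 30 * wp Λ w * wp Λ (z - w) - 5 / 2 * Λ.g₂)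
    (c₀ := fun z => -30 * (wp Λ w * wp' Λ (z - w) + wp' Λ w * wp Λ (z - w)))
    (c₃ := fun z => wp' Λ w * wp'' Λ (z - w) + wp'' Λ w * wp' Λ (z - w)
      + 5 / 2 * Λ.g₂ * (wp' Λ w + wp' Λ (z - w)))
    (g := fun z => 6 * r₁ z - 2 * (-r₂ z + 30 * wp Λ w * (-2 * wp Λ w * wp' Λ w + z * r₀ z))
      - 30 * (wp Λ w * (-6 * wp Λ w * wp' Λ w + 2 * (wp' Λ w ^ 2 + wp Λ w * wp'' Λ w) * z
        + z ^ 2 * r₁ z) + wp' Λ w * (wp'' Λ w / 2 - 2 * wp Λ w * wp' Λ w * z + z ^ 2 * r₀ z)))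
    (by fun_prop) (by fun_prop) (by fun_prop) (by fun_prop) (by fun_prop) (fun z => ?_) ?_
  · simp only [F₁, f₁, f₃, f₄]
    ring
  · filter_upwards [he] with z hz
    rw [hz.1, hz.2.1, hz.2.2, hD]
    linear_combination (54 * z ^ 3) * hQ

lemma tendsto_mul_F₂ {w : ℂ} (hw : w ∉ Λ.lattice) :
    Tendsto (fun z => z * F₂ Λ z w) (𝓝[≠] 0) (𝓝 (108 * Λ.g₃ * wp Λ w + 6 * Λ.g₂ ^ 2)) := by
  obtain ⟨r₀, r₁, r₂, hr₀, hr₁, hr₂, he⟩ := exists_taylor_wp_sub hw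
  have hw' : (0 : ℂ) - w ∉ Λ.lattice := by simpa using hw
  have hV : ContinuousAt (fun z => wp Λ (z - w)) 0 :=
    ContinuousAt.comp_of_eq (analyticAt_wp Λ hw').continuousAt (by fun_prop) rfl
  have hW : ContinuousAt (fun z => wp' Λ (z - w)) 0 :=
    ContinuousAt.comp_of_eq (g := wp' Λ) (analyticAt_wp' Λ hw').continuousAt (by fun_prop) rfl
  have hS : ContinuousAt (fun z => wp'' Λ (z - w)) 0 :=
    ContinuousAt.comp_of_eq (analyticAt_wp'' Λ hw').continuousAt (by fun_prop) rfl
  have hD := wp''_eq Λ hw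
  have hQ : wp' Λ w ^ 2 = 4 * wp Λ w ^ 3 - Λ.g₂ * wp Λ w - Λ.g₃ := Λ.derivWeierstrassP_sq w hw
  -- `c₂`, `c₁`, `c₀`, `c₃` are the coefficients of `℘''(z)`, `℘'(z)`, `℘(z)` and `1`; `g` collects
  -- what the remainders and the higher Taylor coefficients contribute
  refine tendsto_mul_of_principalPart (Λ := Λ)
    (c₂ := fun z => 2 * (wp Λ w * wp' Λ (z - w) + wp' Λ w * wp Λ (z - w)))
    (c₁ := fun z => -2 * (wp'' Λ w * wp Λ (z - w) + wp Λ w * wp'' Λ (z - w))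
      - 9 * wp' Λ w * wp' Λ (z - w) + 5 * Λ.g₂ * (wp Λ w + wp Λ (z - w)) + 15 * Λ.g₃)
    (c₀ := fun z => 2 * (wp'' Λ w * wp' Λ (z - w) + wp' Λ w * wp'' Λ (z - w))
      - 5 * Λ.g₂ * (wp' Λ w + wp' Λ (z - w)))
    (c₃ := fun z => -5 * Λ.g₂ * (wp' Λ w * wp Λ (z - w) + wp Λ w * wp' Λ (z - w))
      - 15 * Λ.g₃ * (wp' Λ w + wp' Λ (z - w)))
    (g := fun z => 12 * (wp Λ w * r₁ z + wp' Λ w * r₀ z)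
      - 2 * ((5 * Λ.g₂ - 2 * wp'' Λ w) * (-2 * wp Λ w * wp' Λ w + z * r₀ z) - 2 * wp Λ w * r₂ z
        - 9 * wp' Λ w * (2 * (wp' Λ w ^ 2 + wp Λ w * wp'' Λ w) + z * r₁ z))
      + (2 * wp'' Λ w - 5 * Λ.g₂) * (-6 * wp Λ w * wp' Λ w
        + 2 * (wp' Λ w ^ 2 + wp Λ w * wp'' Λ w) * z + z ^ 2 * r₁ z)
      + 2 * wp' Λ w * (6 * (wp' Λ w ^ 2 + wp Λ w * wp'' Λ w) + z * r₂ z))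
    (by fun_prop) (by fun_prop) (by fun_prop) (by fun_prop) (by fun_prop) (fun z => ?_) ?_
  · simp only [F₂, f₁, f₂, f₅, f₇]
    ring
  · filter_upwards [he] with z hz
    rw [hz.1, hz.2.1, hz.2.2, hD]
    linear_combination (-30 * z - 108 * wp Λ w * z ^ 3) * hQ

/-! ### The basis of `L(1, 1, 1)` -/

/-- For a function invariant under the automorphisms that permute the three divisors, all pole
orders are at most `1` as soon as `z * F z w` has a limit along `z = 0`. -/
lemma mem_poleSpace_one_of_symm {F : ℂ → ℂ → ℂ} {R : ℂ → ℂ}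
    (hF : restrict Λ F ∈ poleSpace Λ 4 4 4) (hswap : (fun z w => F (-w) (-z)) = F)
    (hsub : (fun z w => F (w - z) w) = F)
    (hR : ∀ w, w ∉ Λ.lattice → Tendsto (fun z => z * F z w) (𝓝[≠] 0) (𝓝 (R w))) :
    restrict Λ F ∈ poleSpace Λ 1 1 1 := by
  have hlim (n : ℕ) (w : ℂ) (hw : w ∉ Λ.lattice) :
      Tendsto (fun z => z ^ (n + 1 + 1) * F z w) (𝓝[≠] 0) (𝓝 0) := by
    have h1 : Tendsto (fun z : ℂ => z ^ (n + 1)) (𝓝[≠] 0) (𝓝 (0 ^ (n + 1))) :=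
      ((continuous_pow (n + 1)).tendsto 0).mono_left nhdsWithin_le_nhds
    have h2 := h1.mul (hR w hw)
    rw [zero_pow (Nat.succ_ne_zero n), zero_mul] at h2
    refine h2.congr fun z => ?_
    ring
  have hdrop {b c : ℕ} (h : restrict Λ F ∈ poleSpace Λ 4 b c) : restrict Λ F ∈ poleSpace Λ 1 b c :=
    mem_poleSpace_of_tendsto (mem_poleSpace_of_tendsto (mem_poleSpace_of_tendsto h (hlim 2))
      (hlim 1)) (hlim 0)
  have h1 := mem_poleSpace_comp_neg_swap (hdrop hF)
  rw [hswap] at h1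
  have h2 := mem_poleSpace_comp_sub (hdrop h1)
  rw [hsub] at h2
  exact hdrop h2

lemma notMem_poleSpace_zero {F : ℂ → ℂ → ℂ} {b c : ℕ} {w R : ℂ} (hw : w ∉ Λ.lattice)
    (hR : Tendsto (fun z => z * F z w) (𝓝[≠] 0) (𝓝 R)) (hR0 : R ≠ 0) :
    restrict Λ F ∉ poleSpace Λ 0 b c := by
  intro hF
  obtain ⟨h, hh, he⟩ := exists_analyticAt_eq_pow_mul hF hw
  have h1 := tendsto_of_eventually_eq hw hh.continuousAt he
  have h2 : Tendsto (fun z : ℂ => z) (𝓝[≠] 0) (𝓝 0) := nhdsWithin_le_nhds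
  have h3 := h2.mul h1
  simp only [pow_zero, one_mul, zero_mul] at h3
  exact hR0 (tendsto_nhds_unique hR h3)

/-- If `F` is invariant under the automorphisms that permute the three divisors and has a nonzero
residue along `z = 0`, it has a pole along each of them. -/
lemma notMem_poleSpace_of_symm {F : ℂ → ℂ → ℂ} {w R : ℂ} (hw : w ∉ Λ.lattice)
    (hswap : (fun z w => F (-w) (-z)) = F) (hsub : (fun z w => F (w - z) w) = F)
    (hR : Tendsto (fun z => z * F z w) (𝓝[≠] 0) (𝓝 R)) (hR0 : R ≠ 0) :
    restrict Λ F ∉ poleSpace Λ 0 1 1 ∧ restrict Λ F ∉ poleSpace Λ 1 0 1 ∧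
      restrict Λ F ∉ poleSpace Λ 1 1 0 := by
  refine ⟨notMem_poleSpace_zero hw hR hR0, fun h => ?_, fun h => ?_⟩
  · have h1 := mem_poleSpace_comp_neg_swap h
    rw [hswap] at h1
    exact notMem_poleSpace_zero hw hR hR0 h1
  · have h1 := mem_poleSpace_comp_sub h
    rw [hsub] at h1
    exact notMem_poleSpace_zero hw hR hR0 h1

lemma eq_zero_of_affine_wp_eq_zero {α β : ℂ} (h : ∀ w, w ∉ Λ.lattice → α * wp Λ w + β = 0) :
    α = 0 ∧ β = 0 := by
  have h1 := h _ Λ.ω₁_div_two_notMem_lattice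
  have h2 := h _ Λ.ω₂_div_two_notMem_lattice
  have hα : α = 0 := by
    have h3 : α * (wp Λ (Λ.ω₁ / 2) - wp Λ (Λ.ω₂ / 2)) = 0 := by linear_combination h1 - h2
    exact (mul_eq_zero.1 h3).resolve_right (sub_ne_zero.2 (wp_half_ne Λ))
  refine ⟨hα, ?_⟩
  rw [hα] at h1
  linear_combination h1

variable (Λ) in
/-- The residues of `F₁` and `F₂` along `z = 0` are linearly independent. -/
lemma eq_zero_of_residue_eq_zero {a b : ℂ}
    (h : ∀ w, w ∉ Λ.lattice → a * (-36 * Λ.g₂ * wp Λ w - 54 * Λ.g₃) +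
      b * (108 * Λ.g₃ * wp Λ w + 6 * Λ.g₂ ^ 2) = 0) : a = 0 ∧ b = 0 := by
  obtain ⟨h1, h2⟩ := eq_zero_of_affine_wp_eq_zero (Λ := Λ)
    (α := a * (-36 * Λ.g₂) + b * (108 * Λ.g₃)) (β := a * (-54 * Λ.g₃) + b * (6 * Λ.g₂ ^ 2))
    fun w hw => by linear_combination h w hw
  have hΔ := discriminant_ne_zero Λ
  constructor
  · apply (mul_eq_zero.1 (?_ : (Λ.g₂ ^ 3 - 27 * Λ.g₃ ^ 2) * a = 0)).resolve_left hΔ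
    linear_combination (-Λ.g₂ ^ 2 / 36) * h1 + Λ.g₃ / 2 * h2
  · apply (mul_eq_zero.1 (?_ : (Λ.g₂ ^ 3 - 27 * Λ.g₃ ^ 2) * b = 0)).resolve_left hΔ
    linear_combination (-Λ.g₃ / 4) * h1 + Λ.g₂ / 6 * h2

lemma localEquation_analyticAt (m : ℕ) (u₀ u : ℂ) : AnalyticAt ℂ (localEquation Λ m u₀) u := by
  unfold localEquation
  split_ifs <;> fun_prop

variable (Λ) in
lemma one_mem_poleSpace (a b c : ℕ) : (1 : offDivisors Λ → ℂ) ∈ poleSpace Λ a b c := by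
  refine ⟨fun _ _ _ _ => rfl, fun p => ⟨divisorEquation Λ a b c p, ?_,
    .of_forall fun q hq => by simp⟩⟩
  refine (AnalyticAt.fun_mul ?_ ?_).fun_mul ?_
  · exact (localEquation_analyticAt a p.1 p.1).comp_of_eq analyticAt_fst rfl
  · exact (localEquation_analyticAt b p.2 p.2).comp_of_eq analyticAt_snd rfl
  · exact (localEquation_analyticAt c (p.1 - p.2) (p.1 - p.2)).comp_of_eq
      (f := fun q : ℂ × ℂ => q.1 - q.2) (analyticAt_fst.sub analyticAt_snd) rfl

variable (Λ) in
lemma linearIndependent_one_F₁_F₂ :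
    LinearIndependent ℂ ![(1 : offDivisors Λ → ℂ), restrict Λ (F₁ Λ), restrict Λ (F₂ Λ)] := by
  rw [Fintype.linearIndependent_iff]
  intro g hg
  have hpt (q : offDivisors Λ) :
      g 0 + g 1 * F₁ Λ q.1.1 q.1.2 + g 2 * F₂ Λ q.1.1 q.1.2 = 0 := by
    have := congrFun hg q
    simpa [Fin.sum_univ_three, restrict] using this
  have h12 := eq_zero_of_residue_eq_zero Λ (a := g 1) (b := g 2) fun w hw => by
    have h1 : Tendsto (fun z : ℂ => z) (𝓝[≠] 0) (𝓝 0) := nhdsWithin_le_nhds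
    have h2 := ((h1.const_mul (g 0)).add ((tendsto_mul_F₁ hw).const_mul (g 1))).add
      ((tendsto_mul_F₂ hw).const_mul (g 2))
    rw [mul_zero, zero_add] at h2
    refine tendsto_nhds_unique h2 (tendsto_const_nhds.congr' ?_)
    filter_upwards [eventually_mem_offDivisors (zero_mem Λ.lattice) hw] with z hz
    linear_combination (-z) * hpt ⟨(z, w), hz⟩
  have h0 : g 0 = 0 := by
    obtain ⟨z, hz⟩ := (eventually_mem_offDivisors (zero_mem Λ.lattice)
      Λ.ω₁_div_two_notMem_lattice).exists
    have := hpt ⟨_, hz⟩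
    rw [h12.1, h12.2] at this
    simpa using this
  intro i
  fin_cases i
  exacts [h0, h12.1, h12.2]

/-- The residue along `z = 0` of a function in `L(1, 1, 1)` is an elliptic function of `w` whose
only pole is at most double and lies at the origin. -/
lemma exists_tendsto_affine_wp {F : ℂ → ℂ → ℂ} (hF : restrict Λ F ∈ poleSpace Λ 1 1 1) :
    ∃ α β, ∀ w, w ∉ Λ.lattice →
      Tendsto (fun z => z * F z w) (𝓝[≠] 0) (𝓝 (α + β * wp Λ w)) := by
  classical
  let R : ℂ → ℂ := fun w => if w ∈ Λ.lattice then 0 else limUnder (𝓝[≠] 0) fun z => z * F z w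
  have hRdef {w r : ℂ} (hw : w ∉ Λ.lattice)
      (h : Tendsto (fun z => z * F z w) (𝓝[≠] 0) (𝓝 r)) : R w = r := by
    simp only [R, if_neg hw]
    exact h.limUnder_eq
  have hR {w : ℂ} (hw : w ∉ Λ.lattice) : Tendsto (fun z => z * F z w) (𝓝[≠] 0) (𝓝 (R w)) := by
    obtain ⟨h, hh, he⟩ := exists_analyticAt_eq_pow_mul hF hw
    have h1 := tendsto_of_eventually_eq hw hh.continuousAt he
    simp only [pow_one] at h1
    rwa [hRdef hw h1]
  -- near every point of the line `z = 0` the residue is read off from a local holomorphic multiple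
  have hloc (w₀ : ℂ) : ∃ H : ℂ → ℂ, AnalyticAt ℂ H w₀ ∧ ∀ᶠ w in 𝓝[≠] w₀,
      H w = localEquation Λ 1 w₀ w * localEquation Λ 1 (0 - w₀) (0 - w) * R w := by
    obtain ⟨h, hh, he⟩ := hF.2 (0, w₀)
    have hline (w : ℂ) : ContinuousAt (fun w : ℂ => ((0 : ℂ), w)) w := by fun_prop
    refine ⟨fun w => h (0, w), hh.comp_of_eq (f := fun w : ℂ => ((0 : ℂ), w))
      (analyticAt_const.prod analyticAt_id) rfl, ?_⟩
    have hev := (hline w₀).eventually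
      (he.eventually_nhds.and (hh.eventually_analyticAt.mono fun q hq => hq.continuousAt))
    filter_upwards [nhdsWithin_le_nhds hev, eventually_notMem_lattice Λ w₀] with w h1 hw
    have h2 : Tendsto (fun z => h (z, w)) (𝓝[≠] 0) (𝓝 (h (0, w))) :=
      h1.2.tendsto.comp (tendsto_prodMk_punctured 0 w)
    have hcont : Continuous fun q : ℂ × ℂ =>
        localEquation Λ 1 w₀ q.2 * localEquation Λ 1 (0 - w₀) (q.1 - q.2) :=
      ((localEquation_continuous 1 w₀).comp continuous_snd).mul
        ((localEquation_continuous 1 (0 - w₀)).comp (continuous_fst.sub continuous_snd))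
    have h3 := ((hcont.tendsto (0, w)).comp (tendsto_prodMk_punctured 0 w)).mul (hR hw)
    refine tendsto_nhds_unique h2 (h3.congr' ?_)
    filter_upwards [(tendsto_prodMk_punctured 0 w).eventually h1.1,
      eventually_mem_offDivisors (zero_mem Λ.lattice) hw] with z h4 h5
    rw [h4 h5]
    simp only [Function.comp_apply, divisorEquation, restrict,
      localEquation_of_mem (zero_mem Λ.lattice)]
    ring
  have hell : EllipticPoleLE Λ 2 R := by
    refine .of_zero (fun w l hl => ?_) (fun w₀ hw₀ => ?_) ?_
    · by_cases hw : w ∈ Λ.lattice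
      · simp [R, hw, add_mem hw hl]
      · have hwl : w + l ∉ Λ.lattice := fun h => hw (by simpa using sub_mem h hl)
        refine hRdef hwl ((hR hw).congr' ?_)
        filter_upwards [eventually_mem_offDivisors (zero_mem Λ.lattice) hw,
          eventually_mem_offDivisors (zero_mem Λ.lattice) hwl] with z h1 h2
        have h3 : F z (w + l) = F z w :=
          hF.1 ⟨(z, w), h1⟩ ⟨(z, w + l), h2⟩ (by simp) (by simpa using hl)
        rw [h3]
    · obtain ⟨H, hH, he⟩ := hloc w₀
      have hw₀' : 0 - w₀ ∉ Λ.lattice := by simpa using hw₀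
      refine ⟨H, hH, ?_⟩
      simpa only [localEquation_of_notMem hw₀, localEquation_of_notMem hw₀', one_mul] using he
    · obtain ⟨H, hH, he⟩ := hloc 0
      refine ⟨fun w => -H w, hH.fun_neg, ?_⟩
      filter_upwards [he] with w hw
      rw [hw, sub_zero, localEquation_of_mem (zero_mem Λ.lattice),
        localEquation_of_mem (zero_mem Λ.lattice)]
      ring
  obtain ⟨α, β, hαβ⟩ := hell.eq_affine_wp_of_two
  refine ⟨α, β, fun w hw => ?_⟩
  -- the identity holds at `w` itself because both sides are continuous there
  obtain ⟨h, hh, he⟩ := exists_analyticAt_eq_pow_mul hF hw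
  have hline (w : ℂ) : ContinuousAt (fun w : ℂ => ((0 : ℂ), w)) w := by fun_prop
  have hRh : ∀ᶠ v in 𝓝 w, R v = h (0, v) := by
    have hev := (hline w).eventually
      (he.eventually_nhds.and (hh.eventually_analyticAt.mono fun q hq => hq.continuousAt))
    filter_upwards [hev, (isOpen_compl_lattice Λ).mem_nhds hw] with v h1 hv
    have h2 := tendsto_of_eventually_eq hv h1.2 h1.1
    simp only [pow_one] at h2
    exact hRdef hv h2
  have h1 : Tendsto R (𝓝[≠] w) (𝓝 (R w)) := by
    rw [hRh.self_of_nhds]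
    exact ((hh.continuousAt.comp (hline w)).tendsto.mono_left nhdsWithin_le_nhds).congr'
      (nhdsWithin_le_nhds (hRh.mono fun _ h => h.symm))
  have h2 : Tendsto R (𝓝[≠] w) (𝓝 (α + β * wp Λ w)) :=
    ((((analyticAt_wp Λ hw).continuousAt.tendsto.const_mul β).const_add α).mono_left
      nhdsWithin_le_nhds).congr' ((hαβ w).mono fun _ h => h.symm)
  rw [← tendsto_nhds_unique h1 h2]
  exact hR hw

lemma localEquation_zero (u₀ u : ℂ) : localEquation Λ 0 u₀ u = 1 := by simp [localEquation]

/-- An element of `L(a, b, c)` is analytic off the divisors. -/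
lemma exists_analyticAt_eq_of_mem_offDivisors {F : ℂ → ℂ → ℂ} {a b c : ℕ}
    (hF : restrict Λ F ∈ poleSpace Λ a b c) {p : ℂ × ℂ} (hp : p ∈ offDivisors Λ) :
    ∃ h : ℂ × ℂ → ℂ, AnalyticAt ℂ h p ∧ ∀ᶠ q in 𝓝 p, h q = F q.1 q.2 := by
  obtain ⟨h, hh, he⟩ := hF.2 p
  refine ⟨h, hh, ?_⟩
  have h1 : ∀ᶠ q in 𝓝 p, q.1 ∉ Λ.lattice :=
    eventually_notMem_lattice_of_continuousAt continuousAt_fst hp.1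
  have h2 : ∀ᶠ q in 𝓝 p, q.2 ∉ Λ.lattice :=
    eventually_notMem_lattice_of_continuousAt continuousAt_snd hp.2.1
  have h3 : ∀ᶠ q in 𝓝 p, q.1 - q.2 ∉ Λ.lattice :=
    eventually_notMem_lattice_of_continuousAt (g := fun q : ℂ × ℂ => q.1 - q.2) (by fun_prop)
      hp.2.2
  filter_upwards [he, h1, h2, h3] with q h4 h5 h6 h7
  rw [h4 ⟨h5, h6, h7⟩]
  simp [divisorEquation, localEquation_of_notMem hp.1, localEquation_of_notMem hp.2.1,
    localEquation_of_notMem hp.2.2, restrict]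

variable (Λ) in
lemma eventually_sub_notMem_lattice (a u₀ : ℂ) : ∀ᶠ u in 𝓝[≠] u₀, u - a ∉ Λ.lattice := by
  have ht : Tendsto (fun u => u - a) (𝓝[≠] u₀) (𝓝[≠] (u₀ - a)) := by
    refine tendsto_nhdsWithin_iff.2 ⟨?_, ?_⟩
    · have : ContinuousAt (fun u => u - a) u₀ := by fun_prop
      exact this.tendsto.mono_left nhdsWithin_le_nhds
    · filter_upwards [self_mem_nhdsWithin] with u hne
      simpa using hne
  exact ht.eventually (eventually_notMem_lattice Λ _)

/-- A function in `L(0, 1, 1)` does not depend on `z`: for fixed `w`, its only pole in `z` is at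
most simple and lies at `w`. -/
lemma exists_eq_of_mem_poleSpace_zero_one_one {F : ℂ → ℂ → ℂ}
    (hF : restrict Λ F ∈ poleSpace Λ 0 1 1) {w : ℂ} (hw : w ∉ Λ.lattice) :
    ∃ c, ∀ z, (z, w) ∈ offDivisors Λ → F z w = c := by
  classical
  let f : ℂ → ℂ := fun u => if (u + w, w) ∈ offDivisors Λ then F (u + w) w else 0
  have hoff (u₀ : ℂ) : ∀ᶠ u in 𝓝[≠] u₀, (u + w, w) ∈ offDivisors Λ := by
    filter_upwards [eventually_notMem_lattice Λ u₀, eventually_sub_notMem_lattice Λ (-w) u₀]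
      with u h1 h2
    exact ⟨by simpa using h2, hw, by simpa using h1⟩
  have hell : EllipticPoleLE Λ 1 f := by
    refine ⟨fun u l hl => ?_, fun u₀ => ?_⟩
    · have hadd (v : ℂ) : v + l ∈ Λ.lattice ↔ v ∈ Λ.lattice :=
        Λ.lattice.add_mem_iff_left hl
      have hiff : (u + l + w, w) ∈ offDivisors Λ ↔ (u + w, w) ∈ offDivisors Λ := by
        simp only [offDivisors, Set.mem_ofPred_eq, add_sub_cancel_right, hadd]
        rw [add_right_comm u l w, hadd]
      by_cases h : (u + w, w) ∈ offDivisors Λ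
      · simp only [f, if_pos h, if_pos (hiff.2 h)]
        exact hF.1 ⟨_, h⟩ ⟨_, hiff.2 h⟩ (by simpa using hl) (by simp)
      · simp only [f, if_neg h, if_neg (mt hiff.1 h)]
    · obtain ⟨h, hh, he⟩ := hF.2 (u₀ + w, w)
      have hline : ContinuousAt (fun u => (u + w, w)) u₀ := by fun_prop
      refine ⟨fun u => h (u + w, w), hh.comp_of_eq (f := fun u => (u + w, w))
        ((analyticAt_id.add analyticAt_const).prod analyticAt_const) rfl, ?_⟩
      filter_upwards [nhdsWithin_le_nhds (hline.eventually he), hoff u₀] with u h1 h2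
      rw [h1 h2]
      simp [divisorEquation, localEquation_zero, localEquation_of_notMem hw, restrict, f, h2]
  obtain ⟨c, hc⟩ := hell.eq_const_of_one
  refine ⟨c, fun z hz => ?_⟩
  obtain ⟨h, hh, he⟩ := exists_analyticAt_eq_of_mem_offDivisors hF hz
  have hline : ContinuousAt (fun u => (u + w, w)) (z - w) := by fun_prop
  have hcont : ContinuousAt (fun u => h (u + w, w)) (z - w) :=
    ContinuousAt.comp_of_eq hh.continuousAt hline (by simp)
  have he' : ∀ᶠ u in 𝓝 (z - w), h (u + w, w) = F (u + w) w :=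
    Filter.Tendsto.eventually (f := fun u => (u + w, w)) (by simpa [ContinuousAt] using hline) he
  have h1 : Tendsto (fun u => h (u + w, w)) (𝓝[≠] (z - w)) (𝓝 (F z w)) := by
    have h2 := hcont.tendsto.mono_left (nhdsWithin_le_nhds (s := {z - w}ᶜ))
    rwa [he'.self_of_nhds, sub_add_cancel] at h2
  refine tendsto_nhds_unique h1 (tendsto_const_nhds.congr' ?_)
  filter_upwards [nhdsWithin_le_nhds he', hc (z - w), hoff (z - w)] with u h2 h3 h4
  rw [h2, ← h3]
  simp [f, h4]

/-- `L(0, 1, 1)` consists of the constants. -/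
lemma exists_eq_const_of_mem_poleSpace_zero_one_one {F : ℂ → ℂ → ℂ}
    (hF : restrict Λ F ∈ poleSpace Λ 0 1 1) : ∃ c, ∀ q : offDivisors Λ, restrict Λ F q = c := by
  classical
  choose! g hg using fun w (hw : w ∉ Λ.lattice) => exists_eq_of_mem_poleSpace_zero_one_one hF hw
  -- near every point `w₀`, `g w = F z w` for a suitable fixed `z`
  have hz (w₀ : ℂ) : ∃ z, z ∉ Λ.lattice ∧ z - w₀ ∉ Λ.lattice :=
    ((eventually_notMem_lattice Λ 0).and (eventually_sub_notMem_lattice Λ w₀ 0)).exists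
  let G : ℂ → ℂ := fun w => if w ∈ Λ.lattice then 0 else g w
  have hG {z w : ℂ} (h : (z, w) ∈ offDivisors Λ) : G w = F z w := by
    have hw : w ∉ Λ.lattice := h.2.1
    simp only [G, if_neg hw]
    exact (hg w hw z h).symm
  have hloc (w₀ : ℂ) : ∃ H : ℂ → ℂ, AnalyticAt ℂ H w₀ ∧ ∀ᶠ w in 𝓝 w₀, w ∉ Λ.lattice →
      H w = localEquation Λ 1 w₀ w * G w := by
    obtain ⟨z, hz1, hz2⟩ := hz w₀
    obtain ⟨h, hh, he⟩ := hF.2 (z, w₀)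
    have hline : ContinuousAt (fun w : ℂ => (z, w)) w₀ := by fun_prop
    refine ⟨fun w => h (z, w), hh.comp_of_eq (f := fun w => (z, w))
      (analyticAt_const.prod analyticAt_id) rfl, ?_⟩
    have hsub : ∀ᶠ w in 𝓝 w₀, z - w ∉ Λ.lattice :=
      eventually_notMem_lattice_of_continuousAt (g := fun w => z - w) (by fun_prop) hz2
    filter_upwards [hline.eventually he, hsub] with w h1 h2 hw
    have hmem : (z, w) ∈ offDivisors Λ := ⟨hz1, hw, h2⟩
    rw [h1 hmem, hG hmem]
    simp [divisorEquation, localEquation_zero, localEquation_of_notMem hz2, restrict]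
  have hell : EllipticPoleLE Λ 1 G := by
    refine ⟨fun w l hl => ?_, fun w₀ => ?_⟩
    · have hadd (v : ℂ) : v + l ∈ Λ.lattice ↔ v ∈ Λ.lattice := Λ.lattice.add_mem_iff_left hl
      by_cases hw : w ∈ Λ.lattice
      · simp only [G, if_pos hw, if_pos ((hadd w).2 hw)]
      · obtain ⟨z, hz1, hz2⟩ := hz w
        have h1 : (z, w) ∈ offDivisors Λ := ⟨hz1, hw, hz2⟩
        have h2 : (z, w + l) ∈ offDivisors Λ := by
          refine ⟨hz1, mt (hadd w).1 hw, fun h => hz2 ?_⟩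
          convert add_mem h hl using 1
          ring
        rw [hG h1, hG h2]
        exact hF.1 ⟨_, h1⟩ ⟨_, h2⟩ (by simp) (by simpa using hl)
    · obtain ⟨H, hH, he⟩ := hloc w₀
      refine ⟨H, hH, ?_⟩
      filter_upwards [nhdsWithin_le_nhds he, eventually_notMem_lattice Λ w₀] with w h1 h2
      exact h1 h2
  obtain ⟨c, hc⟩ := hell.eq_const_of_one
  refine ⟨c, fun q => ?_⟩
  have hw := q.2.2.1
  rw [restrict, ← hG q.2]
  obtain ⟨H, hH, he⟩ := hloc q.1.2
  simp only [localEquation_of_notMem hw, one_mul] at he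
  have h1 := hH.continuousAt.tendsto.mono_left (nhdsWithin_le_nhds (s := {q.1.2}ᶜ))
  rw [he.self_of_nhds hw] at h1
  refine tendsto_nhds_unique h1 (tendsto_const_nhds.congr' ?_)
  filter_upwards [nhdsWithin_le_nhds he, eventually_notMem_lattice Λ q.1.2, hc q.1.2]
    with w h2 h3 h4
  rw [h2 h3, h4]

variable (Λ) in
lemma F₁_mem_poleSpace : restrict Λ (F₁ Λ) ∈ poleSpace Λ 1 1 1 :=
  mem_poleSpace_one_of_symm (productSpace_le_poleSpace Λ (F₁_mem_productSpace Λ)) (F₁_neg_swap Λ)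
    (F₁_sub Λ) fun _ hw => tendsto_mul_F₁ hw

variable (Λ) in
lemma F₂_mem_poleSpace : restrict Λ (F₂ Λ) ∈ poleSpace Λ 1 1 1 :=
  mem_poleSpace_one_of_symm (productSpace_le_poleSpace Λ (F₂_mem_productSpace Λ)) (F₂_neg_swap Λ)
    (F₂_sub Λ) fun _ hw => tendsto_mul_F₂ hw

variable (Λ) in
lemma F₁_notMem_poleSpace : restrict Λ (F₁ Λ) ∉ poleSpace Λ 0 1 1 ∧
    restrict Λ (F₁ Λ) ∉ poleSpace Λ 1 0 1 ∧ restrict Λ (F₁ Λ) ∉ poleSpace Λ 1 1 0 := by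
  obtain ⟨w, hw, hR⟩ : ∃ w, w ∉ Λ.lattice ∧ -36 * Λ.g₂ * wp Λ w - 54 * Λ.g₃ ≠ 0 := by
    by_contra! h
    exact one_ne_zero (eq_zero_of_residue_eq_zero Λ (a := 1) (b := 0)
      fun w hw => by linear_combination h w hw).1
  exact notMem_poleSpace_of_symm hw (F₁_neg_swap Λ) (F₁_sub Λ) (tendsto_mul_F₁ hw) hR

variable (Λ) in
lemma F₂_notMem_poleSpace : restrict Λ (F₂ Λ) ∉ poleSpace Λ 0 1 1 ∧
    restrict Λ (F₂ Λ) ∉ poleSpace Λ 1 0 1 ∧ restrict Λ (F₂ Λ) ∉ poleSpace Λ 1 1 0 := by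
  obtain ⟨w, hw, hR⟩ : ∃ w, w ∉ Λ.lattice ∧ 108 * Λ.g₃ * wp Λ w + 6 * Λ.g₂ ^ 2 ≠ 0 := by
    by_contra! h
    exact one_ne_zero (eq_zero_of_residue_eq_zero Λ (a := 0) (b := 1)
      fun w hw => by linear_combination h w hw).2
  exact notMem_poleSpace_of_symm hw (F₂_neg_swap Λ) (F₂_sub Λ) (tendsto_mul_F₂ hw) hR

variable (Λ) in
lemma poleSpace_le_span : poleSpace Λ 1 1 1 ≤
    Submodule.span ℂ {(1 : offDivisors Λ → ℂ), restrict Λ (F₁ Λ), restrict Λ (F₂ Λ)} := by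
  classical
  intro f hf
  let F : ℂ → ℂ → ℂ := fun z w => if h : (z, w) ∈ offDivisors Λ then f ⟨(z, w), h⟩ else 0
  have hFf : restrict Λ F = f := funext fun q => dif_pos q.2
  rw [← hFf] at hf ⊢
  obtain ⟨α, β, hres⟩ := exists_tendsto_affine_wp hf
  -- Cramer's rule for `a * (residue of F₁) + b * (residue of F₂) = α + β * ℘`
  have hΔ := discriminant_ne_zero Λ
  let a := (18 * Λ.g₃ * α - Λ.g₂ ^ 2 * β) / 36 / (Λ.g₂ ^ 3 - 27 * Λ.g₃ ^ 2)
  let b := (2 * Λ.g₂ * α - 3 * Λ.g₃ * β) / 12 / (Λ.g₂ ^ 3 - 27 * Λ.g₃ ^ 2)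
  have hab (x : ℂ) : α + β * x - a * (-36 * Λ.g₂ * x - 54 * Λ.g₃) -
      b * (108 * Λ.g₃ * x + 6 * Λ.g₂ ^ 2) = 0 := by
    simp only [a, b]
    linear_combination (-(α + β * x)) * mul_inv_cancel₀ hΔ
  have hG : restrict Λ (fun z w => F z w - a * F₁ Λ z w - b * F₂ Λ z w) ∈ poleSpace Λ 0 1 1 := by
    refine mem_poleSpace_of_tendsto (a := 0) (sub_mem (sub_mem hf
      (Submodule.smul_mem _ a (F₁_mem_poleSpace Λ))) (Submodule.smul_mem _ b (F₂_mem_poleSpace Λ)))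
      fun w hw => ?_
    have h1 := ((hres w hw).sub ((tendsto_mul_F₁ hw).const_mul a)).sub
      ((tendsto_mul_F₂ hw).const_mul b)
    rw [hab] at h1
    refine h1.congr fun z => ?_
    ring
  obtain ⟨c, hc⟩ := exists_eq_const_of_mem_poleSpace_zero_one_one hG
  refine Submodule.mem_span_triple.2 ⟨c, a, b, funext fun q => ?_⟩
  have := hc q
  simp only [restrict] at this
  simp only [Pi.add_apply, Pi.smul_apply, Pi.one_apply, smul_eq_mul, restrict]
  linear_combination -this

variable (Λ) in
lemma span_eq_poleSpace :
    Submodule.span ℂ {(1 : offDivisors Λ → ℂ), restrict Λ (F₁ Λ), restrict Λ (F₂ Λ)} =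
      poleSpace Λ 1 1 1 := by
  refine le_antisymm (Submodule.span_le.2 ?_) (poleSpace_le_span Λ)
  rintro f (rfl | rfl | rfl)
  exacts [one_mem_poleSpace Λ 1 1 1, F₁_mem_poleSpace Λ, F₂_mem_poleSpace Λ]

end EllipticSquare

theorem proposition6p3 (Λ : PeriodPair) :
    -- `F₁` and `F₂` lie in `L(1,1,1) ∩ M(4,4,4)`
    (EllipticSquare.restrict Λ (EllipticSquare.F₁ Λ) ∈
        EllipticSquare.poleSpace Λ 1 1 1 ⊓ EllipticSquare.productSpace Λ 1 1 1 ∧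
      EllipticSquare.restrict Λ (EllipticSquare.F₂ Λ) ∈
        EllipticSquare.poleSpace Λ 1 1 1 ⊓ EllipticSquare.productSpace Λ 1 1 1) ∧
    -- the pole along each of the three divisors has order exactly `1`
    (EllipticSquare.restrict Λ (EllipticSquare.F₁ Λ) ∉ EllipticSquare.poleSpace Λ 0 1 1 ∧
      EllipticSquare.restrict Λ (EllipticSquare.F₁ Λ) ∉ EllipticSquare.poleSpace Λ 1 0 1 ∧
      EllipticSquare.restrict Λ (EllipticSquare.F₁ Λ) ∉ EllipticSquare.poleSpace Λ 1 1 0 ∧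
      EllipticSquare.restrict Λ (EllipticSquare.F₂ Λ) ∉ EllipticSquare.poleSpace Λ 0 1 1 ∧
      EllipticSquare.restrict Λ (EllipticSquare.F₂ Λ) ∉ EllipticSquare.poleSpace Λ 1 0 1 ∧
      EllipticSquare.restrict Λ (EllipticSquare.F₂ Λ) ∉ EllipticSquare.poleSpace Λ 1 1 0) ∧
    -- the residues along `z = 0`
    (∀ w : ℂ, w ∉ Λ.lattice →
      Tendsto (fun z => z * EllipticSquare.F₁ Λ z w) (𝓝[≠] 0)
          (𝓝 (-36 * Λ.g₂ * Λ.weierstrassP w - 54 * Λ.g₃)) ∧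
        Tendsto (fun z => z * EllipticSquare.F₂ Λ z w) (𝓝[≠] 0)
          (𝓝 (108 * Λ.g₃ * Λ.weierstrassP w + 6 * Λ.g₂ ^ 2))) ∧
    -- `1`, `F₁`, `F₂` form a basis of `L(1,1,1)`
    LinearIndependent ℂ
      ![(1 : EllipticSquare.offDivisors Λ → ℂ),
        EllipticSquare.restrict Λ (EllipticSquare.F₁ Λ),
        EllipticSquare.restrict Λ (EllipticSquare.F₂ Λ)] ∧
    Submodule.span ℂ
      {(1 : EllipticSquare.offDivisors Λ → ℂ),
        EllipticSquare.restrict Λ (EllipticSquare.F₁ Λ),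
        EllipticSquare.restrict Λ (EllipticSquare.F₂ Λ)} =
      EllipticSquare.poleSpace Λ 1 1 1 :=
  ⟨⟨⟨EllipticSquare.F₁_mem_poleSpace Λ, EllipticSquare.F₁_mem_productSpace Λ⟩,
      EllipticSquare.F₂_mem_poleSpace Λ, EllipticSquare.F₂_mem_productSpace Λ⟩,
    ⟨(EllipticSquare.F₁_notMem_poleSpace Λ).1, (EllipticSquare.F₁_notMem_poleSpace Λ).2.1,
      (EllipticSquare.F₁_notMem_poleSpace Λ).2.2, EllipticSquare.F₂_notMem_poleSpace Λ⟩,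
    fun _ hw => ⟨EllipticSquare.tendsto_mul_F₁ hw, EllipticSquare.tendsto_mul_F₂ hw⟩,
    EllipticSquare.linearIndependent_one_F₁_F₂ Λ, EllipticSquare.span_eq_poleSpace Λ⟩
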